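/- Let $d\ge 1$, let $V\in C^1(\mathbb{R}^d)$ be such that $\mu(dx)=e^{-V(x)}dx$ is a probability measure on $\mathbb{R}^d$, and let $\nu$ be a probability measure on $\mathbb{R}^d$ with compact support; put $R:=\sup\{|z|: z\in\operatorname{supp}\nu\}$. **Notation.** A probability measure $m$ on $\mathbb{R}^d$ satisfies the weak Poincaré inequality with $\alpha$ if there is $r_0>0$ such that $\alpha$ is nonnegative and nonincreasing on $(0,r_0)$ and, for all $f\in C_b^1(\mathbb{R}^d)$ (bounded $C^1$ functions with bounded gradient) with $m(f)=0$, $$m(f^2)\le \alpha(r)\,m(|\nabla f|^2)+r\,\mathrm{Osc}(f)^2,\qquad 0<r<r_0,\qquad \mathrm{Osc}(f)=\sup_{x,y}|f(x)-f(y)|.$$ For a positive continuous function $\phi$ on $\mathbb{R}^d$ and $r>0$ let $\varphi_\phi(r)=\sup\{s>0:\inf_{|x|\le s}\phi\ge 1/r\}\in[0,\infty]$ (with $\sup\emptyset=0$), $$\beta_\phi(r)=\mu\big(|x|\ge \tfrac12\varphi_\phi(r)\big)+\nu\big(|x|\ge \tfrac12\varphi_\phi(r)\big),\qquad \beta_\phi^{-1}(s)=\inf\{r>0:\beta_\phi(r)\le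 s\}.$$ **(a)** Suppose there is $R_0>R$ such that $$\eta(s):=\inf_{|x|=s}\big(\langle\nabla V(x),x\rangle-R|\nabla V(x)|\big)>0,\qquad s\ge R_0.$$ Let $\psi(r)=\frac1r\inf_{r-R\le s\le r+R}\eta(s)$ for $r\ge R_0$ and, for $\sigma>0$ and $r\ge R_0$, $$p_\sigma(r)=\frac{\int_{R_0}^r s^{1-d}\exp\big[\frac{\sigma}{\sigma+1}\int_{R_0}^s\psi(u)\,du\big]ds+1}{r^{1-d}\exp\big[\frac{\sigma}{\sigma+1}\int_{R_0}^r\psi(u)\,du\big]}.$$ Then for every $\sigma>0$ there exist a positive continuous function $\phi$ on $\mathbb{R}^d$ with $$\phi(x)=\frac{\psi(|x|)}{(\sigma+1)p_\sigma(|x|)},\qquad |x|\ge R+R_0,$$ and a constant $c>0$ such that $\mu*\nu$ satisfies the weak Poincaré inequality with $\alpha(r)=c\,\beta_\phi^{-1}(r)$; moreover, for all $r$ large enough, $$\beta_\phi(r)=\mu\big(|x|\ge\tfrac12\varphi_\phi(r),\ |x|\ge R+R_0\big).\qquad (*)$$ **(b)** Suppose $V\in C^2(\mathbb{R}^d)$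 and there are $\delta\in(0,1)$ and $R_0>R$ such that $\delta|\nabla V(x)|^2-\Delta V(x)>0$ for $|x|\ge R_0$. Then there exist a positive continuous function $\phi$ on $\mathbb{R}^d$ with $$\phi(x)=\inf_{|u-x|\le R}\big(\delta|\nabla V(u)|^2-\Delta V(u)\big),\qquad |x|\ge R+R_0,$$ and a constant $c>0$ such that $\mu*\nu$ satisfies the weak Poincaré inequality with $\alpha(r)=c\,\beta_\phi^{-1}(r)$, and $(*)$ holds for all $r$ large enough. -/

import Mathlib

open MeasureTheory Filter Set Metric

noncomputable section

namespace WeakPoincareConv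

/-- Euclidean space `ℝ^d`. -/
abbrev E (d : ℕ) : Type := EuclideanSpace ℝ (Fin d)

variable {d : ℕ}

/-- The measure `μ(dx) = exp(-V(x)) dx`. -/
def gibbs (V : E d → ℝ) : Measure (E d) :=
  volume.withDensity fun x => ENNReal.ofReal (Real.exp (-V x))

/-- `C_b^1(ℝ^d)`: continuously differentiable functions, bounded with bounded gradient. -/
def IsCb1 (f : E d → ℝ) : Prop :=
  ContDiff ℝ 1 f ∧ (∃ C, ∀ x, |f x| ≤ C) ∧ ∃ C, ∀ x, ‖gradient f x‖ ≤ C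

/-- The oscillation `sup_{x,y} |f(x) - f(y)|` (used for bounded `f`). -/
def osc (f : E d → ℝ) : ℝ := ⨆ p : E d × E d, |f p.1 - f p.2|

/-- The weak Poincaré inequality for `m` with rate `α` : on some interval `(0, r₀)` the function
`α` is nonnegative and nonincreasing, and `m(f²) ≤ α(r) m(|∇f|²) + r Osc(f)²` for all
`f ∈ C_b^1` with `m(f) = 0`. -/
def WeakPoincare (m : Measure (E d)) (α : ℝ → ℝ) : Prop :=
  ∃ r₀ : ℝ, 0 < r₀ ∧ (∀ r ∈ Ioo 0 r₀, 0 ≤ α r) ∧ AntitoneOn α (Ioo 0 r₀) ∧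
    ∀ f : E d → ℝ, IsCb1 f → ∫ x, f x ∂m = 0 → ∀ r ∈ Ioo 0 r₀,
      ∫ x, f x ^ 2 ∂m ≤ α r * ∫ x, ‖gradient f x‖ ^ 2 ∂m + r * osc f ^ 2

/-- `φ_ϕ(r) = sup {s > 0 : inf_{|x| ≤ s} ϕ ≥ 1/r}`, a supremum in `[0, ∞]`
(it is `∞` when the set is unbounded). -/
def levelRadius (ϕ : E d → ℝ) (r : ℝ) : ENNReal :=
  ⨆ (s : ℝ) (_ : 0 < s ∧ 1 / r ≤ sInf (ϕ '' closedBall 0 s)), ENNReal.ofReal s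

/-- `β_ϕ(r) = μ(|x| ≥ φ_ϕ(r)/2) + ν(|x| ≥ φ_ϕ(r)/2)`. -/
def beta (μ ν : Measure (E d)) (ϕ : E d → ℝ) (r : ℝ) : ℝ :=
  μ.real {x | levelRadius ϕ r / 2 ≤ ‖x‖ₑ} + ν.real {x | levelRadius ϕ r / 2 ≤ ‖x‖ₑ}

/-- The generalized inverse `F⁻¹(s) = inf {r > 0 : F(r) ≤ s}` of a nonincreasing function on
`(0, ∞)`. -/
def genInv (F : ℝ → ℝ) (s : ℝ) : ℝ := sInf {r : ℝ | 0 < r ∧ F r ≤ s}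

/-- `R = sup {|z| : z ∈ supp ν}`. -/
def supportRadius (ν : Measure (E d)) : ℝ := sSup ((fun z => ‖z‖) '' ν.support)

/-- `η(s) = inf_{|x| = s} (⟨∇V(x), x⟩ - R |∇V(x)|)`. -/
def eta (V : E d → ℝ) (R s : ℝ) : ℝ :=
  sInf ((fun x => inner ℝ (gradient V x) x - R * ‖gradient V x‖) '' sphere 0 s)

/-- `ψ(r) = r⁻¹ inf_{r - R ≤ s ≤ r + R} η(s)`. -/
def psi (V : E d → ℝ) (R r : ℝ) : ℝ := 1 / r * sInf (eta V R '' Icc (r - R) (r + R))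

/-- `w(r) = r^{1-d} exp[σ/(σ+1) ∫_{R₀}^r ψ(u) du]`. -/
def weight (d : ℕ) (ψ : ℝ → ℝ) (σ R₀ r : ℝ) : ℝ :=
  r ^ (1 - (d : ℤ)) * Real.exp (σ / (σ + 1) * ∫ u in R₀..r, ψ u)

/-- `p_σ(r) = (∫_{R₀}^r w(s) ds + 1) / w(r)`. -/
def pSigma (d : ℕ) (ψ : ℝ → ℝ) (σ R₀ r : ℝ) : ℝ :=
  ((∫ s in R₀..r, weight d ψ σ R₀ s) + 1) / weight d ψ σ R₀ r

/-- `δ |∇V(x)|² - ΔV(x)`. -/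
def gradLap (V : E d → ℝ) (δ : ℝ) (x : E d) : ℝ :=
  δ * ‖gradient V x‖ ^ 2 - Laplacian.laplacian V x

/-- For `r` large enough, `β_ϕ(r) = μ(|x| ≥ φ_ϕ(r)/2, |x| ≥ ρ)`. -/
def BetaIsTail (μ ν : Measure (E d)) (ϕ : E d → ℝ) (ρ : ℝ) : Prop :=
  ∀ᶠ r in atTop, beta μ ν ϕ r = μ.real {x | levelRadius ϕ r / 2 ≤ ‖x‖ₑ ∧ ρ ≤ ‖x‖}

end WeakPoincareConv

end

open scoped Topology

namespace WeakPoincareConv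

variable {d : ℕ}

/-! The convolution `μ * ν` is the `ν`-average of the translates `exp(-V(x - z)) dx` with `z ∈ supp
ν`, so it is enough to prove one inequality for every translate, with constants and centring
independent of `z`.

For a potential `U`, suppose that a field `B` satisfies `div B - ⟨∇U, B⟩ + |B|² ≤ -κφ` outside a
ball. For `B = ∇ log W` the left side is `LW / W` with `L = Δ - ⟨∇U, ∇⟩`, so this is a Lyapunov
condition. Integrating the divergence of `g² exp(-U) B` gives the Hardy inequality
`hardy_of_riccati`. Combined with the Poincaré inequality on a ball, it bounds the integral of `(f -
c)²` over `{φ ≥ 1/r}` by `C (r + 1) ∫ |∇f|²` (`exists_superlevel_poincare`). Here `c` is the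
Lebesgue mean of `f` over a fixed ball and `C` sees `U` only through a bound on that ball. Hence
nothing depends on `z`, and averaging over `ν` (`conv_superlevel_le`) creates no variance between
the translates.

The set `{φ < 1/r}` lies in `{|x| ≥ φ_ϕ(r)}`, whose mass under `μ * ν` is at most `β_ϕ(r)`, and
there `|f - c| ≤ Osc(f)`. This yields the weak inequality (`weakPoincare_of_superlevel`).

It remains to exhibit the fields: `(1 - δ) ∇V(x - z)` for (b), and for (a) the radial field `x /
(|x| p_σ(|x|))`, the same for all `z`, where `1 / p_σ` solves a Riccati equation. -/

/-! ### Gradient and divergence calculus -/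

/-- The divergence of a vector field on `ℝ^d`. -/
noncomputable def divg (B : E d → E d) (x : E d) : ℝ :=
  ∑ i, fderiv ℝ B x (EuclideanSpace.single i 1) i

theorem gradient_apply_coord (f : E d → ℝ) (x : E d) (i : Fin d) :
    gradient f x i = fderiv ℝ f x (EuclideanSpace.single i 1) := by
  rw [← inner_gradient_left, EuclideanSpace.inner_single_right]
  simp

theorem gradient_mul_eq {f g : E d → ℝ} {x : E d} (hf : DifferentiableAt ℝ f x)
    (hg : DifferentiableAt ℝ g x) :
    gradient (fun y => f y * g y) x = f x • gradient g x + g x • gradient f x := by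
  ext i
  simp only [gradient_apply_coord, PiLp.add_apply, PiLp.smul_apply, smul_eq_mul]
  rw [fderiv_fun_mul hf hg]
  simp

theorem norm_gradient_eq (f : E d → ℝ) (x : E d) : ‖gradient f x‖ = ‖fderiv ℝ f x‖ := by
  rw [← toDual_gradient, LinearIsometryEquiv.norm_map]

theorem continuous_gradient {f : E d → ℝ} (hf : ContDiff ℝ 1 f) : Continuous (gradient f) :=
  (InnerProductSpace.toDual ℝ (E d)).symm.continuous.comp (hf.continuous_fderiv one_ne_zero)

theorem gradient_sub_const (f : E d → ℝ) (c : ℝ) :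
    gradient (fun x => f x - c) = gradient f := by
  ext x : 1
  simp only [gradient, fderiv_sub_const]

/-- Each `∂ᵢXᵢ` integrates to zero, by integration by parts against the constant function `1`. -/
theorem integral_divg_eq_zero {X : E d → E d} (hX : ContDiff ℝ 1 X) (hc : HasCompactSupport X) :
    ∫ x, divg X x = 0 := by
  have hXi (i : Fin d) (v : E d) : Continuous fun x => fderiv ℝ X x v i := by
    have := hX.continuous_fderiv one_ne_zero
    fun_prop
  have hci (i : Fin d) (v : E d) : HasCompactSupport fun x => fderiv ℝ X x v i :=
    (hc.fderiv ℝ).comp_left (g := fun L : E d →L[ℝ] E d => L v i) (by simp)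
  have hint (i : Fin d) (v : E d) : Integrable fun x => fderiv ℝ X x v i :=
    (hXi i v).integrable_of_hasCompactSupport (hci i v)
  simp only [divg]
  rw [integral_finsetSum _ fun i _ => hint i _]
  refine Finset.sum_eq_zero fun i _ => ?_
  set v : E d := EuclideanSpace.single i 1
  have hd : Differentiable ℝ X := hX.differentiable one_ne_zero
  have hfd (x : E d) : fderiv ℝ (fun y => X y i) x v = fderiv ℝ X x v i := by
    have := ((EuclideanSpace.proj i : E d →L[ℝ] ℝ).hasFDerivAt.comp x (hd x).hasFDerivAt).fderiv
    have h2 : (fun y => X y i) = (EuclideanSpace.proj i : E d →L[ℝ] ℝ) ∘ X := rfl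
    rw [h2, this]
    rfl
  have key := integral_mul_fderiv_eq_neg_fderiv_mul_of_integrable (𝕜 := ℝ)
    (f := fun _ : E d => (1 : ℝ)) (g := fun y => X y i) (v := v) (μ := volume)
    (by simp) (by simpa [hfd] using hint i v)
    (by
      have h1 : Continuous fun y => X y i := by
        have := hX.continuous
        fun_prop
      have h2 : HasCompactSupport fun y => X y i :=
        hc.comp_left (g := fun w : E d => w i) (by simp)
      simpa using h1.integrable_of_hasCompactSupport h2)
    (by fun_prop) (by fun_prop)
  simpa [hfd] using key

/-- Integration against the Gibbs measure. -/
theorem integral_gibbs {U : E d → ℝ} (hU : Continuous U) (h : E d → ℝ) :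
    ∫ x, h x ∂gibbs U = ∫ x, Real.exp (-U x) * h x := by
  rw [gibbs, integral_withDensity_eq_integral_toReal_smul (by fun_prop)
    (Eventually.of_forall fun _ => ENNReal.ofReal_lt_top)]
  simp [ENNReal.toReal_ofReal (Real.exp_pos _).le]

theorem divg_mul_field {u : E d → ℝ} {B : E d → E d} {x : E d} (hu : DifferentiableAt ℝ u x)
    (hB : DifferentiableAt ℝ B x) :
    divg (fun y => u y • B y) x = inner ℝ (gradient u x) (B x) + u x * divg B x := by
  simp only [divg]
  rw [fderiv_fun_smul hu hB, PiLp.inner_apply, Finset.mul_sum, ← Finset.sum_add_distrib]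
  refine Finset.sum_congr rfl fun i _ => ?_
  simp [gradient_apply_coord]
  ring

theorem gradient_exp_neg {U : E d → ℝ} {x : E d} (hU : DifferentiableAt ℝ U x) :
    gradient (fun y => Real.exp (-U y)) x = -(Real.exp (-U x)) • gradient U x := by
  ext i
  simp only [gradient_apply_coord, PiLp.smul_apply, smul_eq_mul]
  have := (hU.hasFDerivAt.fun_neg.exp).fderiv
  rw [this]
  simp

/-! ### Hardy inequality from a Riccati condition -/

/-- Weighted Hardy inequality from a Lyapunov-type (Riccati) condition outside a ball. -/
theorem hardy_of_riccati {U φ : E d → ℝ} {B : E d → E d} {K κ : ℝ} (hU : ContDiff ℝ 1 U)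
    (hφ : Continuous φ) (hB : ContDiffOn ℝ 1 B {x | K < ‖x‖})
    (hR : ∀ x, K < ‖x‖ →
      divg B x - inner ℝ (gradient U x) (B x) + ‖B x‖ ^ 2 ≤ -(κ * φ x))
    {g : E d → ℝ} (hg : ContDiff ℝ 1 g) (hgc : HasCompactSupport g)
    (hg0 : ∀ x, ‖x‖ ≤ K + 1 → g x = 0) :
    ∫ x, κ * φ x * g x ^ 2 ∂gibbs U ≤ ∫ x, ‖gradient g x‖ ^ 2 ∂gibbs U := by
  have hopen : IsOpen {x : E d | K < ‖x‖} := isOpen_lt continuous_const continuous_norm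
  set u : E d → ℝ := fun y => g y ^ 2 * Real.exp (-U y) with hu
  have hu1 : ContDiff ℝ 1 u := by fun_prop
  -- `B` is only controlled for `|x| > K`. As `g` vanishes up to radius `K + 1`, the product is
  -- globally `C¹`.
  set X : E d → E d := fun y => u y • B y with hX
  have hzero (x : E d) (hx : ¬ K < ‖x‖) : g =ᶠ[𝓝 x] fun _ => 0 := by
    have : ∀ᶠ y in 𝓝 x, ‖y‖ < K + 1 :=
      (isOpen_lt continuous_norm continuous_const).mem_nhds (by simp at hx ⊢; linarith)
    filter_upwards [this] with y hy using hg0 y hy.le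
  have hXz (x : E d) (hx : ¬ K < ‖x‖) : X =ᶠ[𝓝 x] fun _ => 0 := by
    filter_upwards [hzero x hx] with y hy
    simp [hX, hu, hy]
  have hX1 : ContDiff ℝ 1 X := by
    refine contDiff_iff_contDiffAt.2 fun x => ?_
    by_cases hx : K < ‖x‖
    · exact hu1.contDiffAt.smul (hB.contDiffAt (hopen.mem_nhds hx))
    · exact contDiffAt_const.congr_of_eventuallyEq (hXz x hx)
  have hXc : HasCompactSupport X := by
    refine hgc.mono fun x hx => ?_
    contrapose! hx
    simp only [Function.mem_support, not_not] at hx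
    simp [hX, hu, hx]
  have hdiv := integral_divg_eq_zero hX1 hXc
  have hgd : Differentiable ℝ g := hg.differentiable one_ne_zero
  have hUd : Differentiable ℝ U := hU.differentiable one_ne_zero
  have hpt (x : E d) : divg X x ≤
      Real.exp (-U x) * (‖gradient g x‖ ^ 2) - Real.exp (-U x) * (κ * φ x * g x ^ 2) := by
    by_cases hx : K < ‖x‖
    · have hBx := (hB.contDiffAt (hopen.mem_nhds hx)).differentiableAt one_ne_zero
      rw [hX, divg_mul_field (hu1.differentiable one_ne_zero x) hBx]
      have e1 : gradient u x = Real.exp (-U x) • ((2 * g x) • gradient g x - g x ^ 2 • gradient U x) := by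
        rw [hu, gradient_mul_eq (by fun_prop) (by fun_prop), gradient_exp_neg (hUd x)]
        have : (fun y => g y ^ 2) = fun y => g y * g y := by ext; ring
        rw [this, gradient_mul_eq (hgd x) (hgd x)]
        module
      rw [e1, real_inner_smul_left, inner_sub_left, real_inner_smul_left, real_inner_smul_left]
      -- Young's inequality; it produces the `|B|²` term of the Riccati condition.
      have h2 : 2 * g x * inner ℝ (gradient g x) (B x) ≤ ‖gradient g x‖ ^ 2 + g x ^ 2 * ‖B x‖ ^ 2 := by
        have := norm_sub_sq_real (gradient g x) (g x • B x)
        rw [norm_smul, inner_smul_right, mul_pow, Real.norm_eq_abs, sq_abs] at this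
        nlinarith [sq_nonneg ‖gradient g x - g x • B x‖]
      have h3 := mul_le_mul_of_nonneg_left (hR x hx) (sq_nonneg (g x))
      have h4 := Real.exp_pos (-U x)
      simp only [hu]
      have : 2 * g x * inner ℝ (gradient g x) (B x) - g x ^ 2 * inner ℝ (gradient U x) (B x)
          + g x ^ 2 * divg B x ≤ ‖gradient g x‖ ^ 2 - κ * φ x * g x ^ 2 := by nlinarith
      nlinarith
    · have e1 : divg X x = 0 := by
        simp [divg, (hXz x hx).fderiv_eq]
      have e2 : g x = 0 := (hzero x hx).eq_of_nhds
      have e3 : gradient g x = 0 := by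
        rw [(hzero x hx).gradient_eq]; simp
      simp [e1, e2, e3]
  have hgr := continuous_gradient hg
  have hgrc : HasCompactSupport (gradient g) :=
    (hgc.fderiv ℝ).comp_left (g := (InnerProductSpace.toDual ℝ (E d)).symm) (by simp)
  have hUc := hU.continuous
  have i1 : Integrable fun x => Real.exp (-U x) * (‖gradient g x‖ ^ 2) := by
    refine Continuous.integrable_of_hasCompactSupport (by fun_prop) ?_
    exact HasCompactSupport.mul_left (hgrc.comp_left (g := fun w => ‖w‖ ^ 2) (by simp))
  have i2 : Integrable fun x => Real.exp (-U x) * (κ * φ x * g x ^ 2) := by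
    refine Continuous.integrable_of_hasCompactSupport (by fun_prop) ?_
    exact HasCompactSupport.mul_left
      (HasCompactSupport.mul_left (hgc.comp_left (g := fun w => w ^ 2) (by simp)))
  have i0 : Integrable (divg X) := by
    refine Continuous.integrable_of_hasCompactSupport ?_ ?_
    · have := hX1.continuous_fderiv one_ne_zero
      unfold divg
      fun_prop
    · exact (hXc.fderiv ℝ).comp_left
        (g := fun L : E d →L[ℝ] E d => ∑ i, L (EuclideanSpace.single i 1) i) (by simp)
  have hfin := integral_mono i0 (i1.sub i2) hpt
  rw [hdiv, integral_sub' i1 i2] at hfin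
  rw [integral_gibbs hUc, integral_gibbs hUc]
  linarith

theorem norm_gradient_mul_le {f g : E d → ℝ} {x : E d} (hf : DifferentiableAt ℝ f x)
    (hg : DifferentiableAt ℝ g x) :
    ‖gradient (fun y => f y * g y) x‖ ≤ |f x| * ‖gradient g x‖ + |g x| * ‖gradient f x‖ := by
  rw [gradient_mul_eq hf hg]
  refine (norm_add_le _ _).trans ?_
  simp [norm_smul]

theorem exists_norm_gradient_le {f : E d → ℝ} (hf : ContDiff ℝ 1 f) (hc : HasCompactSupport f) :
    ∃ C, 0 ≤ C ∧ ∀ x, ‖gradient f x‖ ≤ C := by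
  obtain ⟨C, hC⟩ := (hc.fderiv ℝ).exists_bound_of_continuous (hf.continuous_fderiv one_ne_zero)
  exact ⟨C, (norm_nonneg _).trans (hC 0), fun x => (norm_gradient_eq f x).trans_le (hC x)⟩

/-- A sequence of smooth cutoffs increasing to `1` with gradients tending to `0`. -/
theorem exists_cutoff_seq (d : ℕ) : ∃ (θ : ℕ → E d → ℝ) (ε : ℕ → ℝ),
    (∀ n, ContDiff ℝ 1 (θ n)) ∧ (∀ n, HasCompactSupport (θ n)) ∧
    (∀ n x, |θ n x| ≤ 1) ∧ (∀ x, Tendsto (fun n => θ n x) atTop (𝓝 1)) ∧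
    (∀ n x, ‖gradient (θ n) x‖ ≤ ε n) ∧ Tendsto ε atTop (𝓝 0) := by
  let b : ContDiffBump (0 : E d) := ⟨1, 2, one_pos, one_lt_two⟩
  obtain ⟨C, hC0, hC⟩ := exists_norm_gradient_le (b.contDiff (n := 1)) b.hasCompactSupport
  refine ⟨fun n x => b (((n : ℝ) + 1)⁻¹ • x), fun n => ((n : ℝ) + 1)⁻¹ * C, fun n => ?_,
    fun n => ?_, fun n x => ?_, fun x => ?_, fun n x => ?_, ?_⟩
  · exact (b.contDiff (n := 1)).comp (by fun_prop)
  · exact b.hasCompactSupport.comp_smul (by positivity)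
  · rw [abs_of_nonneg b.nonneg]; exact b.le_one
  · have h1 : Tendsto (fun n : ℕ => ((n : ℝ) + 1)⁻¹ • x) atTop (𝓝 ((0 : ℝ) • x)) := by
      refine Tendsto.smul_const ?_ x
      simpa using tendsto_one_div_add_atTop_nhds_zero_nat (𝕜 := ℝ)
    have h2 : b 0 = 1 := b.one_of_mem_closedBall (by simp [b])
    rw [zero_smul] at h1
    have := (b.continuous.tendsto 0).comp h1
    rwa [h2] at this
  · have h0 : (0 : ℝ) ≤ ((n : ℝ) + 1)⁻¹ := by positivity
    rw [norm_gradient_eq, fderiv_comp_smul, norm_smul, ← norm_gradient_eq, Real.norm_eq_abs,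
      abs_of_nonneg h0]
    exact mul_le_mul_of_nonneg_left (hC _) h0
  · have := (tendsto_one_div_add_atTop_nhds_zero_nat (𝕜 := ℝ)).mul_const C
    simpa using this

theorem integrable_of_bounded {m : Measure (E d)} [IsFiniteMeasure m] {f : E d → ℝ}
    (hf : Continuous f) {C : ℝ} (h : ∀ x, |f x| ≤ C) : Integrable f m :=
  Integrable.of_bound hf.aestronglyMeasurable C (Eventually.of_forall h)

theorem IsCb1.integrable_sq {m : Measure (E d)} [IsFiniteMeasure m] {f : E d → ℝ}
    (hf : IsCb1 f) : Integrable (fun x => f x ^ 2) m := by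
  obtain ⟨h1, ⟨C, hC⟩, -⟩ := hf
  have := h1.continuous
  refine integrable_of_bounded (by fun_prop) (C := C ^ 2) fun x => ?_
  rw [abs_pow]
  exact pow_le_pow_left₀ (abs_nonneg _) (hC x) 2

theorem IsCb1.integrable_gradient_sq {m : Measure (E d)} [IsFiniteMeasure m] {f : E d → ℝ}
    (hf : IsCb1 f) : Integrable (fun x => ‖gradient f x‖ ^ 2) m := by
  obtain ⟨h1, -, C, hC⟩ := hf
  have := continuous_gradient h1
  refine integrable_of_bounded (by fun_prop) (C := C ^ 2) fun x => ?_
  rw [abs_pow, abs_norm]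
  exact pow_le_pow_left₀ (norm_nonneg _) (hC x) 2

/-- This removes the compact support: the Hardy inequality is applied to `G θₙ`, and the cutoff
gradients vanish in the limit. The factor `2` comes from `(a + b)² ≤ 2a² + 2b²`. Replacing the
weight `φ` by its lower bound `a` on a superlevel set keeps the integrand bounded, so dominated
convergence applies. -/
theorem superlevel_le_of_riccati {U φ : E d → ℝ} {B : E d → E d} {K κ : ℝ} (hU : ContDiff ℝ 1 U)
    [IsFiniteMeasure (gibbs U)]
    (hφ : Continuous φ) (hφ0 : ∀ x, 0 ≤ φ x) (hκ : 0 ≤ κ) (hB : ContDiffOn ℝ 1 B {x | K < ‖x‖})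
    (hR : ∀ x, K < ‖x‖ →
      divg B x - inner ℝ (gradient U x) (B x) + ‖B x‖ ^ 2 ≤ -(κ * φ x))
    {G : E d → ℝ} (hG : IsCb1 G) (hG0 : ∀ x, ‖x‖ ≤ K + 1 → G x = 0) (a : ℝ) :
    κ * a * ∫ x in {x | a ≤ φ x}, G x ^ 2 ∂gibbs U ≤ 2 * ∫ x, ‖gradient G x‖ ^ 2 ∂gibbs U := by
  obtain ⟨θ, ε, hθ1, hθc, hθb, hθt, hθg, hε⟩ := exists_cutoff_seq d
  have hGsq := hG.integrable_sq (m := gibbs U)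
  have hGg := hG.integrable_gradient_sq (m := gibbs U)
  obtain ⟨hG1, ⟨M, hM⟩, -⟩ := hG
  have hA : MeasurableSet {x | a ≤ φ x} := measurableSet_le measurable_const hφ.measurable
  have hGc := hG1.continuous
  have hM0 : 0 ≤ M := (abs_nonneg _).trans (hM 0)
  have step (n : ℕ) : κ * a * ∫ x in {x | a ≤ φ x}, (G x * θ n x) ^ 2 ∂gibbs U ≤
      2 * ∫ x, ‖gradient G x‖ ^ 2 ∂gibbs U + 2 * (M * ε n) ^ 2 * (gibbs U).real univ := by
    have hg1 : ContDiff ℝ 1 fun x => G x * θ n x := hG1.mul (hθ1 n)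
    have hgc : HasCompactSupport fun x => G x * θ n x := (hθc n).mul_left
    have h1 := hardy_of_riccati hU hφ hB hR hg1 hgc
      (fun x hx => by simp [hG0 x hx])
    have hθcn := (hθ1 n).continuous
    have hi : Integrable (fun x => κ * φ x * (G x * θ n x) ^ 2) (gibbs U) := by
      have hc : HasCompactSupport fun x => κ * φ x * (G x * θ n x) ^ 2 :=
        HasCompactSupport.mul_left (hgc.comp_left (g := fun w => w ^ 2) (by simp))
      obtain ⟨C, hC⟩ := hc.exists_bound_of_continuous (by fun_prop)
      exact integrable_of_bounded (by fun_prop) hC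
    have hnn (x : E d) : 0 ≤ κ * φ x * (G x * θ n x) ^ 2 :=
      mul_nonneg (mul_nonneg hκ (hφ0 x)) (sq_nonneg _)
    have hb1 (x : E d) : (G x * θ n x) ^ 2 ≤ M ^ 2 := by
      rw [← sq_abs, abs_mul]
      refine pow_le_pow_left₀ (by positivity) ?_ 2
      exact (mul_le_of_le_one_right (abs_nonneg _) (hθb n x)).trans (hM x)
    have hi2 : Integrable (fun x => (G x * θ n x) ^ 2) (gibbs U) :=
      integrable_of_bounded (by fun_prop) (C := M ^ 2) fun x => by
        rw [abs_of_nonneg (sq_nonneg _)]; exact hb1 x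
    have h2 : κ * a * ∫ x in {x | a ≤ φ x}, (G x * θ n x) ^ 2 ∂gibbs U ≤
        ∫ x, κ * φ x * (G x * θ n x) ^ 2 ∂gibbs U := by
      rw [← integral_const_mul]
      refine le_trans (setIntegral_mono_on (hi2.const_mul _).integrableOn hi.integrableOn hA
        fun x hx => ?_) (setIntegral_le_integral hi (Eventually.of_forall hnn))
      exact mul_le_mul_of_nonneg_right (mul_le_mul_of_nonneg_left hx hκ) (sq_nonneg _)
    have h3 : ∫ x, ‖gradient (fun x => G x * θ n x) x‖ ^ 2 ∂gibbs U ≤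
        ∫ x, (2 * ‖gradient G x‖ ^ 2 + 2 * (M * ε n) ^ 2) ∂gibbs U := by
      refine integral_mono_of_nonneg (Eventually.of_forall fun x => by positivity)
        ((hGg.const_mul 2).add (integrable_const _)) (Eventually.of_forall fun x => ?_)
      have h4 := norm_gradient_mul_le (hG1.differentiable one_ne_zero x)
        ((hθ1 n).differentiable one_ne_zero x)
      have h5 : |G x| * ‖gradient (θ n) x‖ ≤ M * ε n :=
        mul_le_mul (hM x) (hθg n x) (norm_nonneg _) hM0
      have h6 : |θ n x| * ‖gradient G x‖ ≤ ‖gradient G x‖ :=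
        mul_le_of_le_one_left (norm_nonneg _) (hθb n x)
      have h7 := pow_le_pow_left₀ (norm_nonneg _) (h4.trans (add_le_add h5 h6)) 2
      nlinarith [sq_nonneg (M * ε n - ‖gradient G x‖)]
    rw [integral_add (hGg.const_mul 2) (integrable_const _), integral_const_mul,
      integral_const, smul_eq_mul] at h3
    linarith
  have hlim1 : Tendsto (fun n => κ * a * ∫ x in {x | a ≤ φ x}, (G x * θ n x) ^ 2 ∂gibbs U) atTop
      (𝓝 (κ * a * ∫ x in {x | a ≤ φ x}, G x ^ 2 ∂gibbs U)) := by
    refine Tendsto.const_mul _ (tendsto_integral_of_dominated_convergence (fun _ => M ^ 2)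
      (fun n => ?_) (integrable_const _) (fun n => Eventually.of_forall fun x => ?_)
      (Eventually.of_forall fun x => ?_))
    · have hθcn := (hθ1 n).continuous
      exact Continuous.aestronglyMeasurable (by fun_prop)
    · rw [Real.norm_eq_abs, abs_pow, abs_mul]
      refine pow_le_pow_left₀ (by positivity) ?_ 2
      exact (mul_le_of_le_one_right (abs_nonneg _) (hθb n x)).trans (hM x)
    · simpa using ((hθt x).const_mul (G x)).pow 2
  have hlim2 : Tendsto (fun n => 2 * ∫ x, ‖gradient G x‖ ^ 2 ∂gibbs U +
      2 * (M * ε n) ^ 2 * (gibbs U).real univ) atTop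
      (𝓝 (2 * ∫ x, ‖gradient G x‖ ^ 2 ∂gibbs U)) := by
    have := ((((hε.const_mul M).pow 2).const_mul 2).mul_const ((gibbs U).real univ)).const_add
      (2 * ∫ x, ‖gradient G x‖ ^ 2 ∂gibbs U)
    simpa using this
  exact le_of_tendsto_of_tendsto' hlim1 hlim2 step

/-! ### Poincaré inequality on balls -/

/-- Cauchy–Schwarz against the constant function. -/
theorem sq_integral_le {α : Type*} [MeasurableSpace α] {m : Measure α} [IsFiniteMeasure m]
    {h : α → ℝ} (h1 : Integrable h m) (h2 : Integrable (fun x => h x ^ 2) m) :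
    (∫ x, h x ∂m) ^ 2 ≤ m.real univ * ∫ x, h x ^ 2 ∂m := by
  set I := ∫ x, h x ∂m
  set c := m.real univ
  have hc : 0 ≤ c := measureReal_nonneg
  have e : ∫ x, (c * h x - I) ^ 2 ∂m = c * (c * (∫ x, h x ^ 2 ∂m) - I ^ 2) := by
    have : (fun x => (c * h x - I) ^ 2) = fun x => (c ^ 2 * h x ^ 2 - 2 * c * I * h x) + I ^ 2 := by
      ext x; ring
    have hs : Integrable (fun x => c ^ 2 * h x ^ 2 - 2 * c * I * h x) m :=
      (h2.const_mul _).sub (h1.const_mul _)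
    rw [this, integral_add hs (integrable_const _), integral_sub (h2.const_mul _) (h1.const_mul _), integral_const_mul, integral_const_mul,
      integral_const, smul_eq_mul]
    simp only [c, I]
    ring
  have hnn : 0 ≤ ∫ x, (c * h x - I) ^ 2 ∂m := integral_nonneg fun x => sq_nonneg _
  rcases hc.eq_or_lt with h0 | h0
  · have : m = 0 := by
      rw [← Measure.measure_univ_eq_zero]
      exact (measureReal_eq_zero_iff).1 h0.symm
    simp [I, this]
  · rw [e] at hnn
    linarith [nonneg_of_mul_nonneg_right hnn h0]

theorem lintegral_comp_smul_add (G : E d → ENNReal) {s : ℝ} (hs : s ≠ 0) (v : E d) :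
    ∫⁻ y, G (s • y + v) = ENNReal.ofReal |(s ^ d)⁻¹| * ∫⁻ y, G y := by
  have h1 : ∫⁻ y, G (s • y + v) = ∫⁻ y, G (y + v) ∂(Measure.map (s • ·) volume) :=
    ((MeasurableEquiv.smul₀ s hs).measurableEmbedding.lintegral_map
      (fun y => G (y + v))).symm
  rw [h1, Measure.map_addHaar_smul volume hs, lintegral_smul_measure,
    lintegral_add_right_eq_self]
  simp

/-- One of `t`, `1 - t` is at least `1/2`. Changing variables in the point carrying that coefficient
costs a Jacobian of at most `2 ^ d`, uniformly in `t`. -/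
theorem lintegral_segment_le (d : ℕ) (B : Set (E d)) (G : E d → ENNReal)
    (hG : Measurable G) (t : ℝ) :
    ∫⁻ x in B, ∫⁻ y in B, G ((1 - t) • y + t • x) ≤
      2 ^ d * volume B * ∫⁻ y, G y := by
  have hs (s : ℝ) (hs : 1 / 2 ≤ s) : ENNReal.ofReal |(s ^ d)⁻¹| ≤ 2 ^ d := by
    rw [abs_of_nonneg (by positivity), ← inv_pow, ENNReal.ofReal_pow (by positivity)]
    refine pow_le_pow_left₀ zero_le (ENNReal.ofReal_le_of_le_toReal ?_) d
    simp only [ENNReal.toReal_ofNat]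
    rw [inv_le_comm₀ (by linarith) two_pos]
    linarith
  have key (s : ℝ) (h : 1 / 2 ≤ s) :
      ∫⁻ x in B, ∫⁻ y in B, G (s • y + (1 - s) • x) ≤ 2 ^ d * volume B * ∫⁻ y, G y := by
    calc ∫⁻ x in B, ∫⁻ y in B, G (s • y + (1 - s) • x)
        ≤ ∫⁻ x in B, 2 ^ d * ∫⁻ y, G y := by
          refine lintegral_mono fun x => (setLIntegral_le_lintegral _ _).trans ?_
          rw [lintegral_comp_smul_add G (by linarith)]
          gcongr
          exact hs s h
      _ = _ := by
          rw [setLIntegral_const]; ring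
  rcases le_total t (1 / 2) with h | h
  · simpa using key (1 - t) (by linarith)
  · rw [lintegral_lintegral_swap]
    · have := key t h
      simpa [add_comm] using this
    · exact Measurable.aemeasurable (by fun_prop)

/-- The fundamental theorem of calculus along the segment, followed by Cauchy–Schwarz in `t` and in
`ℝ^d`. -/
theorem sq_sub_le_segment {f : E d → ℝ} (hf : ContDiff ℝ 1 f) (x y : E d) :
    (f x - f y) ^ 2 ≤
      ∫ t in Icc (0 : ℝ) 1, ‖gradient f ((1 - t) • y + t • x)‖ ^ 2 * ‖x - y‖ ^ 2 := by
  have hg := continuous_gradient hf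
  set h : ℝ → ℝ := fun t => inner ℝ (gradient f ((1 - t) • y + t • x)) (x - y)
  have hc : Continuous h := by fun_prop
  have hd (t : ℝ) : HasDerivAt (fun t : ℝ => f ((1 - t) • y + t • x)) (h t) t := by
    have h1 : HasDerivAt (fun t : ℝ => (1 - t) • y + t • x) (x - y) t := by
      have := (((hasDerivAt_id t).const_sub 1).smul_const y).add ((hasDerivAt_id t).smul_const x)
      refine this.congr_deriv ?_
      simp [sub_eq_add_neg, add_comm]
    have h2 := (hf.differentiable one_ne_zero ((1 - t) • y + t • x)).hasFDerivAt.comp_hasDerivAt t h1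
    simp only [h, inner_gradient_left]
    exact h2
  have e1 : ∫ t in Icc (0 : ℝ) 1, h t = f x - f y := by
    rw [integral_Icc_eq_integral_Ioc, ← intervalIntegral.integral_of_le zero_le_one,
      intervalIntegral.integral_eq_sub_of_hasDerivAt (fun t _ => hd t)
        (hc.intervalIntegrable _ _)]
    simp
  have h2 := sq_integral_le (m := volume.restrict (Icc (0 : ℝ) 1)) (h := h)
    hc.continuousOn.integrableOn_Icc
    (Continuous.continuousOn (by fun_prop)).integrableOn_Icc
  rw [e1] at h2
  simp only [measureReal_restrict_apply_univ, Real.volume_real_Icc, sub_zero, zero_le_one,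
    sup_of_le_left, one_mul] at h2
  refine h2.trans (setIntegral_mono_on (Continuous.continuousOn (by fun_prop)).integrableOn_Icc
    (Continuous.continuousOn (by fun_prop)).integrableOn_Icc measurableSet_Icc fun t _ => ?_)
  rw [← mul_pow, ← sq_abs]
  exact pow_le_pow_left₀ (abs_nonneg _) (abs_real_inner_le_norm _ _) 2

theorem lintegral_sq_sub_le {f : E d → ℝ} (hf : ContDiff ℝ 1 f) (N : ℝ) :
    ∫⁻ x in closedBall (0 : E d) N, ∫⁻ y in closedBall (0 : E d) N,
        ENNReal.ofReal ((f x - f y) ^ 2) ≤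
      ENNReal.ofReal ((2 * N) ^ 2) * (2 ^ d * volume (closedBall (0 : E d) N) *
        ∫⁻ x in closedBall (0 : E d) N, ENNReal.ofReal (‖gradient f x‖ ^ 2)) := by
  set D : Set (E d) := closedBall 0 N
  have hD : MeasurableSet D := measurableSet_closedBall
  have hgc := continuous_gradient hf
  -- Extension by zero loses nothing, because segments between points of the convex set `D` stay in
  -- `D`.
  set G : E d → ENNReal := D.indicator fun z => ENNReal.ofReal (‖gradient f z‖ ^ 2)
  have hG : Measurable G := Measurable.indicator (by fun_prop) hD
  have hpt (x : E d) (hx : x ∈ D) (y : E d) (hy : y ∈ D) : ENNReal.ofReal ((f x - f y) ^ 2) ≤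
      ENNReal.ofReal ((2 * N) ^ 2) * ∫⁻ t in Icc (0 : ℝ) 1, G ((1 - t) • y + t • x) := by
    refine (ENNReal.ofReal_le_ofReal (sq_sub_le_segment hf x y)).trans ?_
    rw [ofReal_integral_eq_lintegral_ofReal
      (Continuous.continuousOn (by fun_prop)).integrableOn_Icc
      (Eventually.of_forall fun t => by positivity), ← lintegral_const_mul _ (by fun_prop)]
    refine setLIntegral_mono (by fun_prop) fun t ht => ?_
    have hmem : (1 - t) • y + t • x ∈ D :=
      (convex_closedBall (0 : E d) N) hy hx (by linarith [ht.2]) ht.1 (by ring)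
    have hxy : ‖x - y‖ ^ 2 ≤ (2 * N) ^ 2 := by
      refine pow_le_pow_left₀ (norm_nonneg _) ?_ 2
      have h1 : ‖x‖ ≤ N := by simpa [D] using hx
      have h2 : ‖y‖ ≤ N := by simpa [D] using hy
      linarith [norm_sub_le x y]
    simp only [G, indicator_of_mem hmem]
    rw [mul_comm, ← ENNReal.ofReal_mul (by positivity)]
    exact ENNReal.ofReal_le_ofReal (mul_le_mul_of_nonneg_right hxy (by positivity))
  have e1 : ∫⁻ z, G z = ∫⁻ x in D, ENNReal.ofReal (‖gradient f x‖ ^ 2) := lintegral_indicator hD _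
  calc ∫⁻ x in D, ∫⁻ y in D, ENNReal.ofReal ((f x - f y) ^ 2)
      ≤ ∫⁻ x in D, ∫⁻ y in D, ENNReal.ofReal ((2 * N) ^ 2) *
          ∫⁻ t in Icc (0 : ℝ) 1, G ((1 - t) • y + t • x) :=
        setLIntegral_mono' hD fun x hx => setLIntegral_mono' hD fun y hy => hpt x hx y hy
    _ = ENNReal.ofReal ((2 * N) ^ 2) * ∫⁻ x in D, ∫⁻ y in D,
          ∫⁻ t in Icc (0 : ℝ) 1, G ((1 - t) • y + t • x) := by
        rw [← lintegral_const_mul' _ _ ENNReal.ofReal_ne_top]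
        simp_rw [lintegral_const_mul' _ _ ENNReal.ofReal_ne_top]
    _ = ENNReal.ofReal ((2 * N) ^ 2) * ∫⁻ t in Icc (0 : ℝ) 1,
          ∫⁻ x in D, ∫⁻ y in D, G ((1 - t) • y + t • x) := by
        congr 1
        have h1 (x : E d) : ∫⁻ y in D, ∫⁻ t in Icc (0 : ℝ) 1, G ((1 - t) • y + t • x) =
            ∫⁻ t in Icc (0 : ℝ) 1, ∫⁻ y in D, G ((1 - t) • y + t • x) :=
          lintegral_lintegral_swap (Measurable.aemeasurable (by fun_prop))
        simp_rw [h1]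
        refine lintegral_lintegral_swap (Measurable.aemeasurable ?_)
        exact Measurable.lintegral_prod_right'
          (f := fun p : (E d × ℝ) × E d => G ((1 - p.1.2) • p.2 + p.1.2 • p.1.1)) (by fun_prop)
    _ ≤ ENNReal.ofReal ((2 * N) ^ 2) * ∫⁻ _ in Icc (0 : ℝ) 1,
          2 ^ d * volume D * ∫⁻ y, G y := by
        gcongr with t
        exact lintegral_segment_le d D G hG t
    _ = _ := by
        rw [setLIntegral_const, e1]
        simp

/-- The Poincaré inequality for Lebesgue measure on a ball. -/
theorem poincare_closedBall {f : E d → ℝ} (hf : ContDiff ℝ 1 f) {N : ℝ} (hN : 0 < N) :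
    ∫ x in closedBall (0 : E d) N, (f x - ⨍ y in closedBall (0 : E d) N, f y) ^ 2 ≤
      (2 * N) ^ 2 * 2 ^ d * ∫ x in closedBall (0 : E d) N, ‖gradient f x‖ ^ 2 := by
  have h0 := lintegral_sq_sub_le hf N
  set D : Set (E d) := closedBall 0 N
  set c : ℝ := ⨍ y in D, f y with hc
  have hgc := continuous_gradient hf
  have hfc := hf.continuous
  have hK : IsCompact D := isCompact_closedBall _ _
  have hint {h : E d → ℝ} (hh : Continuous h) : IntegrableOn h D :=
    hh.continuousOn.integrableOn_compact hK
  have hvol : 0 < volume.real D :=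
    ENNReal.toReal_pos (measure_closedBall_pos _ _ hN).ne' hK.measure_lt_top.ne
  have : IsFiniteMeasure (volume.restrict D) := ⟨by simpa using hK.measure_lt_top⟩
  -- Since `vol(D) (f x - c)` is the integral of `f x - f y` over `y ∈ D`, this is Cauchy–Schwarz
  -- with one factor `vol(D)` cancelled.
  have hA (x : E d) : volume.real D * (f x - c) ^ 2 ≤ ∫ y in D, (f x - f y) ^ 2 := by
    have h1 := sq_integral_le (m := volume.restrict D) (h := fun y => f x - f y)
      (hint (by fun_prop)) (hint (by fun_prop))
    have h2 : ∫ y in D, (f x - f y) = volume.real D * (f x - c) := by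
      rw [integral_sub (integrable_const _) (hint hfc), integral_const, hc, setAverage_eq]
      simp only [measureReal_restrict_apply_univ, smul_eq_mul]
      field_simp
    rw [h2, measureReal_restrict_apply_univ, mul_pow, pow_two (volume.real D), mul_assoc] at h1
    exact le_of_mul_le_mul_left h1 hvol
  have hB : ENNReal.ofReal (volume.real D * ∫ x in D, (f x - c) ^ 2) ≤
      ∫⁻ x in D, ∫⁻ y in D, ENNReal.ofReal ((f x - f y) ^ 2) := by
    rw [← integral_const_mul, ofReal_integral_eq_lintegral_ofReal (hint (by fun_prop))
      (Eventually.of_forall fun x => by positivity)]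
    refine lintegral_mono fun x => ?_
    rw [← ofReal_integral_eq_lintegral_ofReal (hint (by fun_prop))
      (Eventually.of_forall fun x => by positivity)]
    exact ENNReal.ofReal_le_ofReal (hA x)
  have hnn : 0 ≤ ∫ x in D, ‖gradient f x‖ ^ 2 := integral_nonneg fun x => by positivity
  have hC := hB.trans h0
  rw [← ofReal_integral_eq_lintegral_ofReal (hint (by fun_prop))
      (Eventually.of_forall fun x => by positivity)] at hC
  have e2 : volume D = ENNReal.ofReal (volume.real D) :=
    (ENNReal.ofReal_toReal hK.measure_lt_top.ne).symm
  have e3 : (2 : ENNReal) ^ d = ENNReal.ofReal (2 ^ d) := by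
    rw [ENNReal.ofReal_pow two_pos.le]; simp
  rw [e2, e3, ← ENNReal.ofReal_mul (by positivity), ← ENNReal.ofReal_mul (by positivity),
    ← ENNReal.ofReal_mul (by positivity), ENNReal.ofReal_le_ofReal_iff (by positivity)] at hC
  refine le_of_mul_le_mul_left (hC.trans_eq ?_) hvol
  ring

theorem setIntegral_gibbs {U : E d → ℝ} (hU : Continuous U) (h : E d → ℝ) {s : Set (E d)}
    (hs : MeasurableSet s) :
    ∫ x in s, h x ∂gibbs U = ∫ x in s, Real.exp (-U x) * h x := by
  rw [← integral_indicator hs, integral_gibbs hU, ← integral_indicator hs]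
  congr 1 with x
  by_cases hx : x ∈ s <;> simp [hx]

/-- The local Poincaré inequality for a Gibbs measure whose potential is bounded on a ball. -/
theorem local_poincare_gibbs {U : E d → ℝ} (hU : Continuous U) {N M : ℝ} (hN : 0 < N)
    (hM : ∀ x ∈ closedBall (0 : E d) N, |U x| ≤ M) {f : E d → ℝ} (hf : ContDiff ℝ 1 f) :
    ∫ x in closedBall (0 : E d) N, (f x - ⨍ y in closedBall (0 : E d) N, f y) ^ 2 ∂gibbs U ≤
      Real.exp (2 * M) * ((2 * N) ^ 2 * 2 ^ d) *
        ∫ x in closedBall (0 : E d) N, ‖gradient f x‖ ^ 2 ∂gibbs U := by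
  have h0 := poincare_closedBall hf hN
  set D : Set (E d) := closedBall 0 N
  set c : ℝ := ⨍ y in D, f y
  have hgc := continuous_gradient hf
  have hfc := hf.continuous
  have hK : IsCompact D := isCompact_closedBall _ _
  have hD : MeasurableSet D := measurableSet_closedBall
  have hint {h : E d → ℝ} (hh : Continuous h) : IntegrableOn h D :=
    hh.continuousOn.integrableOn_compact hK
  rw [setIntegral_gibbs hU _ hD, setIntegral_gibbs hU _ hD]
  -- On `D` the density lies between `exp(-M)` and `exp M`; each comparison with Lebesgue measure
  -- costs one factor `exp M`.
  have h1 : ∫ x in D, Real.exp (-U x) * (f x - c) ^ 2 ≤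
      Real.exp M * ∫ x in D, (f x - c) ^ 2 := by
    rw [← integral_const_mul]
    refine setIntegral_mono_on (hint (by fun_prop)) (hint (by fun_prop)) hD fun x hx => ?_
    refine mul_le_mul_of_nonneg_right (Real.exp_le_exp.2 ?_) (sq_nonneg _)
    linarith [neg_abs_le (U x), hM x hx]
  have h2 : Real.exp (-M) * ∫ x in D, ‖gradient f x‖ ^ 2 ≤
      ∫ x in D, Real.exp (-U x) * ‖gradient f x‖ ^ 2 := by
    rw [← integral_const_mul]
    refine setIntegral_mono_on (hint (by fun_prop)) (hint (by fun_prop)) hD fun x hx => ?_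
    refine mul_le_mul_of_nonneg_right (Real.exp_le_exp.2 ?_) (sq_nonneg _)
    linarith [le_abs_self (U x), hM x hx]
  have h3 : ∫ x in D, ‖gradient f x‖ ^ 2 ≤
      Real.exp M * ∫ x in D, Real.exp (-U x) * ‖gradient f x‖ ^ 2 := by
    have := mul_le_mul_of_nonneg_left h2 (Real.exp_pos M).le
    rwa [← mul_assoc, ← Real.exp_add, add_neg_cancel, Real.exp_zero, one_mul] at this
  calc _ ≤ Real.exp M * ∫ x in D, (f x - c) ^ 2 := h1
    _ ≤ Real.exp M * ((2 * N) ^ 2 * 2 ^ d * (Real.exp M *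
          ∫ x in D, Real.exp (-U x) * ‖gradient f x‖ ^ 2)) := by
        gcongr
        exact h0.trans (by gcongr)
    _ = _ := by
        rw [two_mul M, Real.exp_add]; ring

/-! ### Variance on superlevel sets of `φ` -/

/-- A smooth function vanishing on the ball of radius `a`, equal to `1` outside the ball of
radius `b`. -/
theorem exists_outer_cutoff (d : ℕ) {a b : ℝ} (ha : 0 < a) (hab : a < b) :
    ∃ (χ : E d → ℝ) (C : ℝ), ContDiff ℝ 1 χ ∧ (∀ x, 0 ≤ χ x) ∧ (∀ x, χ x ≤ 1) ∧
      (∀ x, ‖x‖ ≤ a → χ x = 0) ∧ (∀ x, b ≤ ‖x‖ → χ x = 1) ∧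
      0 ≤ C ∧ (∀ x, ‖gradient χ x‖ ≤ C) ∧ ∀ x, b < ‖x‖ → gradient χ x = 0 := by
  let β : ContDiffBump (0 : E d) := ⟨a, b, ha, hab⟩
  obtain ⟨C, hC0, hC⟩ := exists_norm_gradient_le (β.contDiff (n := 1)) β.hasCompactSupport
  have hcd : ContDiff ℝ 1 fun x => 1 - β x := contDiff_const.sub β.contDiff
  have hout (x : E d) (hx : b ≤ ‖x‖) : 1 - β x = 1 := by
    rw [β.zero_of_le_dist (by simpa [β] using hx), sub_zero]
  refine ⟨fun x => 1 - β x, C, hcd, fun x => sub_nonneg.2 β.le_one,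
    fun x => sub_le_self _ β.nonneg, fun x hx => ?_, hout, hC0, fun x => ?_, fun x hx => ?_⟩
  · simp [β.one_of_mem_closedBall (x := x) (by simpa [β] using hx)]
  · refine le_trans (le_of_eq ?_) (hC x)
    rw [norm_gradient_eq, norm_gradient_eq, fderiv_const_sub, norm_neg]
  · have : (fun x => 1 - β x) =ᶠ[𝓝 x] fun _ => 1 := by
      filter_upwards [(isOpen_lt continuous_const continuous_norm).mem_nhds hx] with y hy
      exact hout y (le_of_lt hy)
    rw [this.gradient_eq, gradient_fun_const]

theorem IsCb1.sub_const {f : E d → ℝ} (hf : IsCb1 f) (c : ℝ) : IsCb1 fun x => f x - c := by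
  obtain ⟨h1, ⟨C, hC⟩, h3⟩ := hf
  refine ⟨h1.sub contDiff_const, ⟨C + |c|, fun x => ?_⟩, ?_⟩
  · exact (abs_sub _ _).trans (by linarith [hC x])
  · simpa only [gradient_sub_const] using h3

theorem IsCb1.mul {f g : E d → ℝ} (hf : IsCb1 f) (hg : IsCb1 g) :
    IsCb1 fun x => f x * g x := by
  obtain ⟨f1, ⟨C, hC⟩, C', hC'⟩ := hf
  obtain ⟨g1, ⟨D, hD⟩, D', hD'⟩ := hg
  have hC0 : 0 ≤ C := (abs_nonneg _).trans (hC 0)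
  have hD0 : 0 ≤ D := (abs_nonneg _).trans (hD 0)
  refine ⟨f1.mul g1, ⟨C * D, fun x => ?_⟩, C * D' + D * C', fun x => ?_⟩
  · rw [abs_mul]
    exact mul_le_mul (hC x) (hD x) (abs_nonneg _) hC0
  · refine (norm_gradient_mul_le (f1.differentiable one_ne_zero x)
      (g1.differentiable one_ne_zero x)).trans (add_le_add ?_ ?_)
    · exact mul_le_mul (hC x) (hD' x) (norm_nonneg _) hC0
    · exact mul_le_mul (hD x) (hC' x) (norm_nonneg _) hD0

/-- The Riccati condition outside a ball and the local Poincaré inequality control the variance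
on the superlevel sets of `φ`, with a constant depending on the potential only through a bound
on a ball. -/
theorem exists_superlevel_poincare (d : ℕ) {K κ M : ℝ} (hK : 0 ≤ K) (hκ : 0 < κ) :
    ∃ C, 0 < C ∧ ∀ (U φ : E d → ℝ) (B : E d → E d), ContDiff ℝ 1 U → IsFiniteMeasure (gibbs U) →
      (∀ x ∈ closedBall (0 : E d) (K + 2), |U x| ≤ M) → Continuous φ → (∀ x, 0 ≤ φ x) →
      ContDiffOn ℝ 1 B {x | K < ‖x‖} →
      (∀ x, K < ‖x‖ → divg B x - inner ℝ (gradient U x) (B x) + ‖B x‖ ^ 2 ≤ -(κ * φ x)) →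
      ∀ f : E d → ℝ, IsCb1 f → ∀ r : ℝ, 0 < r →
      ∫ x in {x | 1 / r ≤ φ x}, (f x - ⨍ y in closedBall (0 : E d) (K + 2), f y) ^ 2 ∂gibbs U ≤
        C * (r + 1) * ∫ x, ‖gradient f x‖ ^ 2 ∂gibbs U := by
  -- The Hardy inequality needs a test function vanishing up to `K + 1`; the transition to `1` is
  -- completed at `K + 2`, the radius of the local Poincaré inequality.
  obtain ⟨χ, L, hχ1, hχ0, hχle, hχin, hχout, hL0, hχg, hχg0⟩ :=
    exists_outer_cutoff d (show 0 < K + 1 by linarith) (show K + 1 < K + 2 by linarith)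
  have hN : 0 < K + 2 := by linarith
  set N := K + 2
  set P : ℝ := Real.exp (2 * M) * ((2 * N) ^ 2 * 2 ^ d)
  have hP : 0 < P := by positivity
  -- The first term multiplies `r` and comes from the Hardy bound for `(f - c) χ`; the second is the
  -- local Poincaré constant.
  refine ⟨4 / κ * (1 + L ^ 2 * P) + P, by positivity, ?_⟩
  intro U φ B hU hfin hM hφ hφ0 hB hR f hf r hr
  have hloc := local_poincare_gibbs hU.continuous hN hM hf.1
  set c : ℝ := ⨍ y in closedBall (0 : E d) N, f y
  set D : Set (E d) := closedBall 0 N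
  have hD : MeasurableSet D := measurableSet_closedBall
  set A : Set (E d) := {x | 1 / r ≤ φ x}
  have hA : MeasurableSet A := measurableSet_le measurable_const hφ.measurable
  have hF : IsCb1 fun x => f x - c := hf.sub_const c
  have hχb : IsCb1 χ := ⟨hχ1, ⟨1, fun x => by rw [abs_of_nonneg (hχ0 x)]; exact hχle x⟩, L, hχg⟩
  have hG : IsCb1 fun x => (f x - c) * χ x := hF.mul hχb
  have hFi := hF.integrable_sq (m := gibbs U)
  have hGi := hG.integrable_sq (m := gibbs U)
  have hfg := hf.integrable_gradient_sq (m := gibbs U)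
  have h1 := superlevel_le_of_riccati hU hφ hφ0 hκ.le hB hR hG
    (fun x hx => by simp [hχin x hx]) (1 / r)
  set I : ℝ := ∫ x, ‖gradient f x‖ ^ 2 ∂gibbs U
  have hlocI : ∫ x in D, (f x - c) ^ 2 ∂gibbs U ≤ P * I :=
    hloc.trans (mul_le_mul_of_nonneg_left
      (setIntegral_le_integral hfg (Eventually.of_forall fun x => by positivity)) hP.le)
  have hind : Integrable (D.indicator fun x => (f x - c) ^ 2) (gibbs U) := hFi.indicator hD
  -- The error `(f - c) ∇χ` lives in `D`, where the local Poincaré inequality controls it.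
  have h2 : ∫ x, ‖gradient (fun x => (f x - c) * χ x) x‖ ^ 2 ∂gibbs U ≤
      2 * I + 2 * L ^ 2 * ∫ x in D, (f x - c) ^ 2 ∂gibbs U := by
    rw [← integral_indicator hD, ← integral_const_mul, ← integral_const_mul,
      ← integral_add (hfg.const_mul 2) (hind.const_mul _)]
    refine integral_mono hG.integrable_gradient_sq ((hfg.const_mul 2).add (hind.const_mul _))
      fun x => ?_
    have h3 := norm_gradient_mul_le (hF.1.differentiable one_ne_zero x)
        (hχ1.differentiable one_ne_zero x)
    rw [gradient_sub_const, abs_of_nonneg (hχ0 x)] at h3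
    have h4 : χ x * ‖gradient f x‖ ≤ ‖gradient f x‖ :=
      mul_le_of_le_one_left (norm_nonneg _) (hχle x)
    have h5 := pow_le_pow_left₀ (norm_nonneg _) (h3.trans (add_le_add_right h4 _)) 2
    refine h5.trans ?_
    by_cases hx : x ∈ D
    · simp only [indicator_of_mem hx]
      have h6 : (|f x - c| * ‖gradient χ x‖) ^ 2 ≤ L ^ 2 * (f x - c) ^ 2 := by
        rw [mul_pow, sq_abs, mul_comm]
        gcongr
        exact hχg x
      nlinarith [sq_nonneg (|f x - c| * ‖gradient χ x‖ - ‖gradient f x‖)]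
    · have hx' : N < ‖x‖ := by simpa [D] using hx
      simp only [indicator_of_notMem hx, hχg0 x hx']
      simp only [norm_zero, mul_zero, zero_add, add_zero]
      nlinarith [sq_nonneg ‖gradient f x‖]
  have h3 : ∫ x in A, (f x - c) ^ 2 ∂gibbs U ≤
      ∫ x in A, ((f x - c) * χ x) ^ 2 ∂gibbs U + ∫ x in D, (f x - c) ^ 2 ∂gibbs U := by
    calc _ ≤ ∫ x in A, (((f x - c) * χ x) ^ 2 + D.indicator (fun x => (f x - c) ^ 2) x) ∂gibbs U := by
          refine setIntegral_mono_on hFi.integrableOn (hGi.add hind).integrableOn hA fun x _ => ?_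
          by_cases hx : x ∈ D
          · simp only [indicator_of_mem hx]
            exact le_add_of_nonneg_left (sq_nonneg _)
          · have hx' : N < ‖x‖ := by simpa [D] using hx
            simp [indicator_of_notMem hx, hχout x hx'.le]
      _ = ∫ x in A, ((f x - c) * χ x) ^ 2 ∂gibbs U +
            ∫ x in A, D.indicator (fun x => (f x - c) ^ 2) x ∂gibbs U :=
          integral_add hGi.integrableOn hind.integrableOn
      _ ≤ _ := by
          gcongr
          rw [← integral_indicator hD]
          exact setIntegral_le_integral hind
            (Eventually.of_forall fun x => indicator_nonneg (fun _ _ => sq_nonneg _) x)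
  have h4 : ∫ x in A, ((f x - c) * χ x) ^ 2 ∂gibbs U ≤ r / κ * (4 * (1 + L ^ 2 * P) * I) := by
    have h5 : κ * (1 / r) * ∫ x in A, ((f x - c) * χ x) ^ 2 ∂gibbs U ≤
        4 * (1 + L ^ 2 * P) * I := by
      refine h1.trans ?_
      have := mul_le_mul_of_nonneg_left hlocI (show 0 ≤ 2 * L ^ 2 by positivity)
      linarith
    have h6 := mul_le_mul_of_nonneg_left h5 (show 0 ≤ r / κ by positivity)
    refine le_trans (le_of_eq ?_) h6
    field_simp
  have hI0 : 0 ≤ I := integral_nonneg fun x => by positivity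
  calc _ ≤ r / κ * (4 * (1 + L ^ 2 * P) * I) + P * I := h3.trans (add_le_add h4 hlocI)
    _ = (4 / κ * (1 + L ^ 2 * P) * r + P) * I := by field_simp
    _ ≤ _ := by
        refine mul_le_mul_of_nonneg_right ?_ hI0
        have : 0 ≤ 4 / κ * (1 + L ^ 2 * P) := by positivity
        nlinarith

/-! ### The convolution as a mixture of translated Gibbs measures -/

theorem lintegral_gibbs_translate {V : E d → ℝ} (hV : Continuous V) {h : E d → ENNReal}
    (hh : Measurable h) (z : E d) :
    ∫⁻ x, h (x + z) ∂gibbs V = ∫⁻ x, h x ∂gibbs fun x => V (x - z) := by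
  rw [gibbs, gibbs, lintegral_withDensity_eq_lintegral_mul _ (by fun_prop) (by fun_prop),
    lintegral_withDensity_eq_lintegral_mul _ (by fun_prop) hh]
  rw [← lintegral_add_right_eq_self
    ((fun x => ENNReal.ofReal (Real.exp (-V (x - z)))) * fun x => h x) z]
  simp

theorem gibbs_translate_univ {V : E d → ℝ} (hV : Continuous V) (z : E d) :
    gibbs (fun x => V (x - z)) univ = gibbs V univ := by
  have := lintegral_gibbs_translate hV (h := fun _ => 1) measurable_const z
  simpa using this.symm

theorem lintegral_conv_gibbs {V : E d → ℝ} (hV : Continuous V) [IsFiniteMeasure (gibbs V)]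
    (ν : Measure (E d)) [IsFiniteMeasure ν] {h : E d → ENNReal} (hh : Measurable h) :
    ∫⁻ x, h x ∂Measure.conv (gibbs V) ν =
      ∫⁻ z, ∫⁻ x, h x ∂gibbs (fun x => V (x - z)) ∂ν := by
  rw [Measure.conv, lintegral_map hh (by fun_prop), lintegral_prod_symm _ (by fun_prop)]
  simp_rw [lintegral_gibbs_translate hV hh]

/-- Integrating an inequality that is uniform over the translated measures. -/
theorem conv_superlevel_le {V : E d → ℝ} (hV : Continuous V) [IsFiniteMeasure (gibbs V)]
    (ν : Measure (E d)) [IsFiniteMeasure ν] {A : Set (E d)} (hA : MeasurableSet A)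
    {f : E d → ℝ} (hf : IsCb1 f) {c C : ℝ} (hC : 0 ≤ C)
    (h : ∀ z ∈ ν.support, ∫ x in A, (f x - c) ^ 2 ∂gibbs (fun x => V (x - z)) ≤
      C * ∫ x, ‖gradient f x‖ ^ 2 ∂gibbs (fun x => V (x - z))) :
    ∫ x in A, (f x - c) ^ 2 ∂Measure.conv (gibbs V) ν ≤
      C * ∫ x, ‖gradient f x‖ ^ 2 ∂Measure.conv (gibbs V) ν := by
  have hF := hf.sub_const c
  have hfc := hf.1.continuous
  have hgc := continuous_gradient hf.1
  have hnn1 (x : E d) : 0 ≤ A.indicator (fun x => (f x - c) ^ 2) x :=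
    indicator_nonneg (fun _ _ => sq_nonneg _) x
  have hm1 : Measurable fun x => ENNReal.ofReal (A.indicator (fun x => (f x - c) ^ 2) x) := by
    refine ENNReal.measurable_ofReal.comp (Measurable.indicator (by fun_prop) hA)
  have hI0 : 0 ≤ ∫ x, ‖gradient f x‖ ^ 2 ∂Measure.conv (gibbs V) ν :=
    integral_nonneg fun x => by positivity
  rw [← ENNReal.ofReal_le_ofReal_iff (by positivity), ENNReal.ofReal_mul hC,
    ← integral_indicator hA,
    ofReal_integral_eq_lintegral_ofReal (hF.integrable_sq.indicator hA)
      (Eventually.of_forall hnn1),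
    ofReal_integral_eq_lintegral_ofReal hf.integrable_gradient_sq
      (Eventually.of_forall fun x => by positivity),
    lintegral_conv_gibbs hV ν hm1, lintegral_conv_gibbs hV ν (by fun_prop),
    ← lintegral_const_mul' _ _ ENNReal.ofReal_ne_top]
  refine lintegral_mono_ae ?_
  -- The support carries all of `ν`, so the hypothesis on `supp ν` suffices.
  filter_upwards [Measure.support_mem_ae (μ := ν)] with z hz
  have : IsFiniteMeasure (gibbs fun x => V (x - z)) :=
    ⟨by rw [gibbs_translate_univ hV]; exact measure_lt_top _ _⟩
  rw [← ofReal_integral_eq_lintegral_ofReal (hF.integrable_sq.indicator hA)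
      (Eventually.of_forall hnn1),
    ← ofReal_integral_eq_lintegral_ofReal hf.integrable_gradient_sq
      (Eventually.of_forall fun x => by positivity), ← ENNReal.ofReal_mul hC,
    integral_indicator hA]
  exact ENNReal.ofReal_le_ofReal (h z hz)

/-! ### From superlevel sets to the weak Poincaré inequality -/

theorem abs_sub_le_osc {f : E d → ℝ} (hf : ∃ C, ∀ x, |f x| ≤ C) (x y : E d) :
    |f x - f y| ≤ osc f := by
  obtain ⟨C, hC⟩ := hf
  refine le_ciSup (f := fun p : E d × E d => |f p.1 - f p.2|) ⟨C + C, ?_⟩ (x, y)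
  rintro _ ⟨p, rfl⟩
  exact (abs_sub _ _).trans (add_le_add (hC _) (hC _))

theorem abs_sub_average_le_osc {f : E d → ℝ} (hf : IsCb1 f) {N : ℝ} (hN : 0 < N) (x : E d) :
    |f x - ⨍ y in closedBall (0 : E d) N, f y| ≤ osc f := by
  set D : Set (E d) := closedBall 0 N
  have hK : IsCompact D := isCompact_closedBall _ _
  have hvol : 0 < volume.real D :=
    ENNReal.toReal_pos (measure_closedBall_pos _ _ hN).ne' hK.measure_lt_top.ne
  have : IsFiniteMeasure (volume.restrict D) := ⟨by simpa using hK.measure_lt_top⟩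
  have hfc := hf.1.continuous
  have h2 : ∫ y in D, (f x - f y) = volume.real D * (f x - ⨍ y in D, f y) := by
    rw [integral_sub (integrable_const _) (hfc.continuousOn.integrableOn_compact hK),
      integral_const, setAverage_eq]
    simp only [measureReal_restrict_apply_univ, smul_eq_mul]
    field_simp
  have hK' : volume D < ⊤ := hK.measure_lt_top
  have h3 := norm_setIntegral_le_of_norm_le_const (f := fun y => f x - f y)
    hK' fun y _ => abs_sub_le_osc hf.2.1 x y
  rw [h2, norm_mul, Real.norm_eq_abs, Real.norm_eq_abs, abs_of_pos hvol, mul_comm (osc f)] at h3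
  exact le_of_mul_le_mul_left h3 hvol

theorem lt_of_enorm_lt_levelRadius {φ : E d → ℝ} (hφ0 : ∀ x, 0 < φ x) {r : ℝ} {x : E d}
    (hx : ‖x‖ₑ < levelRadius φ r) : 1 / r ≤ φ x := by
  simp only [levelRadius, lt_iSup_iff] at hx
  obtain ⟨s, ⟨hs, h1⟩, h2⟩ := hx
  rw [← ofReal_norm, ENNReal.ofReal_lt_ofReal_iff hs] at h2
  refine h1.trans (csInf_le ⟨0, ?_⟩ ⟨x, by simpa using h2.le, rfl⟩)
  rintro _ ⟨y, -, rfl⟩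
  exact (hφ0 y).le

/-- A positive continuous function has a positive minimum on each ball, so the level radius tends to
infinity with `r`. -/
theorem exists_le_levelRadius {φ : E d → ℝ} (hφ : Continuous φ) (hφ0 : ∀ x, 0 < φ x) {s : ℝ}
    (hs : 0 < s) : ∃ r₁ : ℝ, 0 < r₁ ∧ ∀ r, r₁ ≤ r → ENNReal.ofReal s ≤ levelRadius φ r := by
  obtain ⟨x₀, -, hx₀⟩ := (isCompact_closedBall (0 : E d) s).exists_isMinOn
    (nonempty_closedBall.2 hs.le) hφ.continuousOn
  refine ⟨(φ x₀)⁻¹, inv_pos.2 (hφ0 x₀), fun r hr => ?_⟩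
  refine le_iSup₂_of_le s ⟨hs, ?_⟩ le_rfl
  refine le_csInf ((nonempty_closedBall.2 hs.le).image _) ?_
  rintro _ ⟨y, hy, rfl⟩
  refine le_trans ?_ (hx₀ hy)
  rw [one_div]
  exact inv_le_of_inv_le₀ (hφ0 x₀) hr

theorem levelRadius_eq_zero {φ : E d → ℝ} (hφ0 : ∀ x, 0 < φ x) {r : ℝ} (h : φ 0 < 1 / r) :
    levelRadius φ r = 0 := by
  simp only [levelRadius, ENNReal.iSup_eq_zero]
  rintro s ⟨hs, h1⟩
  refine absurd (h1.trans (csInf_le ⟨0, ?_⟩ ⟨0, by simpa using hs.le, rfl⟩)) (not_le.2 h)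
  rintro _ ⟨y, -, rfl⟩
  exact (hφ0 y).le

theorem measurableSet_le_enorm (L : ENNReal) : MeasurableSet {x : E d | L ≤ ‖x‖ₑ} :=
  measurableSet_le measurable_const continuous_enorm.measurable

/-- If `|x + y| ≥ L`, then `|x| ≥ L/2` or `|y| ≥ L/2`. This explains the factor `1/2` in `β_ϕ`. -/
theorem conv_tail_le (μ ν : Measure (E d)) [IsProbabilityMeasure μ] [IsProbabilityMeasure ν]
    (L : ENNReal) : (Measure.conv μ ν).real {x | L ≤ ‖x‖ₑ} ≤
      μ.real {x | L / 2 ≤ ‖x‖ₑ} + ν.real {x | L / 2 ≤ ‖x‖ₑ} := by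
  have hsub : (fun p : E d × E d => p.1 + p.2) ⁻¹' {x | L ≤ ‖x‖ₑ} ⊆
      ({x | L / 2 ≤ ‖x‖ₑ} ×ˢ univ) ∪ (univ ×ˢ {x | L / 2 ≤ ‖x‖ₑ}) := by
    rintro ⟨x, y⟩ h
    by_contra hc
    simp only [mem_union, mem_prod, mem_ofPred_eq, mem_univ, and_true, true_and, not_or,
      not_le] at hc
    have h1 : ‖x + y‖ₑ < L :=
      (enorm_add_le x y).trans_lt ((ENNReal.add_lt_add hc.1 hc.2).trans_eq (ENNReal.add_halves L))
    exact absurd h (not_le.2 h1)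
  have h1 : (Measure.conv μ ν) {x | L ≤ ‖x‖ₑ} ≤ μ {x | L / 2 ≤ ‖x‖ₑ} + ν {x | L / 2 ≤ ‖x‖ₑ} := by
    rw [Measure.conv, Measure.map_apply (by fun_prop) (measurableSet_le_enorm L)]
    refine (measure_mono hsub).trans ((measure_union_le _ _).trans_eq ?_)
    rw [Measure.prod_prod, Measure.prod_prod]
    simp
  simp only [measureReal_def]
  rw [← ENNReal.toReal_add (measure_ne_top _ _) (measure_ne_top _ _)]
  exact ENNReal.toReal_mono (by finiteness) h1

theorem tendsto_tail (μ : Measure (E d)) [IsFiniteMeasure μ] :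
    Tendsto (fun n : ℕ => μ.real {x | (n : ENNReal) ≤ ‖x‖ₑ}) atTop (𝓝 0) := by
  have h := tendsto_measure_iInter_atTop (μ := μ) (s := fun n : ℕ => {x : E d | (n : ENNReal) ≤ ‖x‖ₑ})
    (fun n => (measurableSet_le_enorm _).nullMeasurableSet)
    (fun m n hmn x hx => le_trans (by exact_mod_cast hmn) (show (n : ENNReal) ≤ ‖x‖ₑ from hx))
    ⟨0, measure_ne_top _ _⟩
  have h0 : ⋂ n : ℕ, {x : E d | (n : ENNReal) ≤ ‖x‖ₑ} = ∅ := by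
    refine eq_empty_of_forall_notMem fun x hx => ?_
    obtain ⟨n, hn⟩ := ENNReal.exists_nat_gt (enorm_ne_top (x := x))
    exact absurd (mem_iInter.1 hx n) (not_le.2 hn)
  rw [h0, measure_empty] at h
  exact (ENNReal.tendsto_toReal ENNReal.zero_ne_top).comp h

/-- This makes the infimum defining `genInv` range over a nonempty set; for an empty set `sInf`
would take the default value `0`. -/
theorem exists_beta_le {φ : E d → ℝ} (hφ : Continuous φ) (hφ0 : ∀ x, 0 < φ x)
    (μ ν : Measure (E d)) [IsFiniteMeasure μ] [IsFiniteMeasure ν] {r : ℝ} (hr : 0 < r) :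
    ∃ t, 0 < t ∧ beta μ ν φ t ≤ r := by
  have h := (tendsto_tail μ).add (tendsto_tail ν)
  rw [add_zero] at h
  obtain ⟨n, hn⟩ := (h.eventually (gt_mem_nhds hr)).exists
  obtain ⟨t, ht, hle⟩ := exists_le_levelRadius hφ hφ0 (show (0 : ℝ) < 2 * (n + 1) by positivity)
  refine ⟨t, ht, le_trans ?_ hn.le⟩
  have hL : (n : ENNReal) ≤ levelRadius φ t / 2 := by
    rw [ENNReal.le_div_iff_mul_le (by simp) (by simp)]
    refine le_trans ?_ (hle t le_rfl)
    rw [ENNReal.le_ofReal_iff_toReal_le (by finiteness) (by positivity)]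
    simp
    linarith
  have hsub : {x : E d | levelRadius φ t / 2 ≤ ‖x‖ₑ} ⊆ {x | (n : ENNReal) ≤ ‖x‖ₑ} :=
    fun x hx => hL.trans hx
  exact add_le_add (measureReal_mono hsub) (measureReal_mono hsub)

/-- Once the level radius reaches `2ρ`, the constraint `|x| ≥ ρ` is automatic and the `ν`-term
vanishes because `ρ > R`. -/
theorem betaIsTail_of_ae_norm_le {φ : E d → ℝ} (hφ : Continuous φ) (hφ0 : ∀ x, 0 < φ x)
    (μ ν : Measure (E d)) {R ρ : ℝ} (hρ : 0 < ρ) (hRρ : R < ρ)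
    (hν : ∀ᵐ x ∂ν, ‖x‖ ≤ R) : BetaIsTail μ ν φ ρ := by
  obtain ⟨t, ht, hle⟩ := exists_le_levelRadius hφ hφ0 (show (0 : ℝ) < 2 * ρ by positivity)
  filter_upwards [eventually_ge_atTop t] with r hr
  have hL (x : E d) (hx : levelRadius φ r / 2 ≤ ‖x‖ₑ) : ρ ≤ ‖x‖ := by
    have h1 : ENNReal.ofReal ρ ≤ levelRadius φ r / 2 := by
      rw [ENNReal.le_div_iff_mul_le (by simp) (by simp)]
      refine le_trans (le_of_eq ?_) (hle r hr)
      rw [mul_comm 2 ρ, ENNReal.ofReal_mul hρ.le]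
      simp
    have h2 := h1.trans hx
    rwa [← ofReal_norm, ENNReal.ofReal_le_ofReal_iff (norm_nonneg _)] at h2
  have e1 : {x : E d | levelRadius φ r / 2 ≤ ‖x‖ₑ ∧ ρ ≤ ‖x‖} =
      {x | levelRadius φ r / 2 ≤ ‖x‖ₑ} := by
    ext x
    exact ⟨fun h => h.1, fun h => ⟨h, hL x h⟩⟩
  have e2 : ν.real {x | levelRadius φ r / 2 ≤ ‖x‖ₑ} = 0 := by
    rw [measureReal_def, ENNReal.toReal_eq_zero_iff]
    left
    refine measure_mono_null (fun x hx => ?_) (ae_iff.1 hν)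
    exact not_le.2 (hRρ.trans_le (hL x hx))
  rw [beta, e1, e2, add_zero]

/-- Control of the variance on superlevel sets of `φ` implies the weak Poincaré inequality. -/
theorem weakPoincare_of_superlevel {φ : E d → ℝ} (hφ : Continuous φ) (hφ0 : ∀ x, 0 < φ x)
    (μ ν : Measure (E d)) [IsProbabilityMeasure μ] [IsProbabilityMeasure ν] {C N : ℝ} (hC : 0 < C)
    (hN : 0 < N)
    (h : ∀ f : E d → ℝ, IsCb1 f → ∀ r : ℝ, 0 < r →
      ∫ x in {x | 1 / r ≤ φ x},
        (f x - ⨍ y in closedBall (0 : E d) N, f y) ^ 2 ∂Measure.conv μ ν ≤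
        C * (r + 1) * ∫ x, ‖gradient f x‖ ^ 2 ∂Measure.conv μ ν) :
    ∃ c : ℝ, 0 < c ∧ WeakPoincare (Measure.conv μ ν) fun r => c * genInv (beta μ ν φ) r := by
  have hbdd (r : ℝ) : BddBelow {t : ℝ | 0 < t ∧ beta μ ν φ t ≤ r} := ⟨0, fun t ht => ht.1.le⟩
  have hne {r : ℝ} (hr : 0 < r) : {t : ℝ | 0 < t ∧ beta μ ν φ t ≤ r}.Nonempty := by
    obtain ⟨t, ht⟩ := exists_beta_le hφ hφ0 μ ν hr
    exact ⟨t, ht⟩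
  have hφ00 := hφ0 0
  -- The factor `1 + φ 0` turns `t + 1` into a multiple of `t`, which requires `t ≥ 1 / φ 0`; the
  -- choice `r₀ = 1` guarantees this bound.
  refine ⟨C * (1 + φ 0), by positivity, 1, one_pos, fun r _ => ?_, fun r hr r' hr' hrr' => ?_, ?_⟩
  · exact mul_nonneg (by positivity) (Real.sInf_nonneg fun t ht => ht.1.le)
  · refine mul_le_mul_of_nonneg_left ?_ (by positivity)
    exact csInf_le_csInf (hbdd _) (hne hr.1) fun t ht => ⟨ht.1, ht.2.trans hrr'⟩
  intro f hf hf0 r hr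
  set m := Measure.conv μ ν
  set c : ℝ := ⨍ y in closedBall (0 : E d) N, f y
  set I := ∫ x, ‖gradient f x‖ ^ 2 ∂m
  have hI0 : 0 ≤ I := integral_nonneg fun x => by positivity
  have hF := hf.sub_const c
  have hfi : Integrable f m := by
    obtain ⟨h1, ⟨M, hM⟩, -⟩ := hf
    exact integrable_of_bounded h1.continuous hM
  have hvar : ∫ x, f x ^ 2 ∂m ≤ ∫ x, (f x - c) ^ 2 ∂m := by
    have e : (fun x => (f x - c) ^ 2) = fun x => f x ^ 2 - 2 * c * f x + c ^ 2 := by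
      ext x; ring
    have hi : Integrable (fun x => f x ^ 2 - 2 * c * f x) m := hf.integrable_sq.sub (hfi.const_mul _)
    rw [e, integral_add hi (integrable_const _), integral_sub hf.integrable_sq (hfi.const_mul _),
      integral_const_mul, hf0, integral_const]
    simp [sq_nonneg]
  have key (t : ℝ) (ht : 0 < t) (hβ : beta μ ν φ t ≤ r) :
      ∫ x, f x ^ 2 ∂m - r * osc f ^ 2 ≤ C * (1 + φ 0) * I * t := by
    set A : Set (E d) := {x | 1 / t ≤ φ x}
    have hA : MeasurableSet A := measurableSet_le measurable_const hφ.measurable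
    have h1 := h f hf t ht
    have h2 : ∫ x in Aᶜ, (f x - c) ^ 2 ∂m ≤ r * osc f ^ 2 := by
      calc ∫ x in Aᶜ, (f x - c) ^ 2 ∂m ≤ ∫ _ in Aᶜ, osc f ^ 2 ∂m := by
            refine integral_mono hF.integrable_sq.integrableOn (integrable_const _) fun x => ?_
            simp only [← sq_abs (f x - c)]
            exact pow_le_pow_left₀ (abs_nonneg _) (abs_sub_average_le_osc hf hN x) 2
        _ = m.real Aᶜ * osc f ^ 2 := by
            rw [setIntegral_const, smul_eq_mul]
        _ ≤ r * osc f ^ 2 := by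
            gcongr
            refine le_trans (measureReal_mono fun x hx => ?_)
              ((conv_tail_le μ ν (levelRadius φ t)).trans hβ)
            by_contra hlt
            exact hx (lt_of_enorm_lt_levelRadius hφ0 (not_le.1 hlt))
    -- Otherwise the level radius is `0`, so `β_ϕ(t) = 2`, contradicting `β_ϕ(t) ≤ r < 1`.
    have h3 : 1 ≤ φ 0 * t := by
      by_contra! hlt
      have hz : levelRadius φ t = 0 := levelRadius_eq_zero hφ0 (by rwa [lt_div_iff₀ ht])
      have : beta μ ν φ t = 2 := by
        simp [beta, hz]
        norm_num
      linarith [hr.2]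
    have h4 : C * (t + 1) * I ≤ C * (1 + φ 0) * I * t := by
      have : C * I * (t + 1) ≤ C * I * ((1 + φ 0) * t) :=
        mul_le_mul_of_nonneg_left (by linarith) (by positivity)
      linarith
    have h5 := integral_add_compl hA hF.integrable_sq (μ := m)
    linarith
  have hk0 : 0 ≤ C * (1 + φ 0) * I := by positivity
  suffices ∫ x, f x ^ 2 ∂m - r * osc f ^ 2 ≤ C * (1 + φ 0) * I * genInv (beta μ ν φ) r by
    linarith
  -- The bound `key` is linear in `t`, so it passes to the infimum whether or not it is attained;
  -- dividing by the slope requires it to be nonzero.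
  rcases hk0.eq_or_lt with hk | hk
  · obtain ⟨t, ht, hβ⟩ := hne hr.1
    have := key t ht hβ
    rw [← hk] at this ⊢
    linarith
  · rw [← div_le_iff₀' hk]
    refine le_csInf (hne hr.1) fun t ht => ?_
    rw [div_le_iff₀' hk]
    exact key t ht.1 ht.2

/-! ### Translates, Laplacian and infima over balls -/

theorem gradient_comp_sub (V : E d → ℝ) (z x : E d) :
    gradient (fun y => V (y - z)) x = gradient V (x - z) := by
  simp only [gradient, fderiv_comp_sub]

theorem laplacian_eq_divg_gradient {V : E d → ℝ} (hV : ContDiff ℝ 2 V) (x : E d) :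
    Laplacian.laplacian V x = divg (gradient V) x := by
  rw [InnerProductSpace.laplacian_eq_iteratedFDeriv_orthonormalBasis V
    (EuclideanSpace.basisFun (Fin d) ℝ), divg]
  refine Finset.sum_congr rfl fun i _ => ?_
  rw [iteratedFDeriv_two_apply]
  have h1 : Differentiable ℝ (fderiv ℝ V) :=
    (hV.fderiv_right (m := 1) (by norm_num)).differentiable one_ne_zero
  have h2 : gradient V = (InnerProductSpace.toDual ℝ (E d)).symm ∘ fderiv ℝ V := rfl
  have h3 : fderiv ℝ (gradient V) x (EuclideanSpace.single i 1) =
      (InnerProductSpace.toDual ℝ (E d)).symm (fderiv ℝ (fderiv ℝ V) x (EuclideanSpace.single i 1)) := by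
    have := ((InnerProductSpace.toDual ℝ (E d)).symm.toContinuousLinearEquiv.hasFDerivAt.comp x
      (h1 x).hasFDerivAt).fderiv
    rw [h2]
    exact congrArg (fun L : E d →L[ℝ] E d => L (EuclideanSpace.single i 1)) this
  have h4 (w : E d) : w i = inner ℝ w (EuclideanSpace.single i (1 : ℝ)) := by
    simp [EuclideanSpace.inner_single_right]
  rw [h3, h4, InnerProductSpace.toDual_symm_apply]
  simp

theorem contDiff_gradient {V : E d → ℝ} (hV : ContDiff ℝ 2 V) : ContDiff ℝ 1 (gradient V) :=
  (InnerProductSpace.toDual ℝ (E d)).symm.contDiff.comp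
    (hV.fderiv_right (m := 1) (by norm_num))

theorem continuous_divg {B : E d → E d} (hB : ContDiff ℝ 1 B) : Continuous (divg B) := by
  have := hB.continuous_fderiv one_ne_zero
  unfold divg
  fun_prop

theorem continuous_gradLap {V : E d → ℝ} (hV : ContDiff ℝ 2 V) (δ : ℝ) :
    Continuous (gradLap V δ) := by
  have h1 := continuous_divg (contDiff_gradient hV)
  have h2 := continuous_gradient (hV.of_le (by norm_num : (1 : WithTop ℕ∞) ≤ 2))
  have e : gradLap V δ = fun x => δ * ‖gradient V x‖ ^ 2 - divg (gradient V) x := by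
    ext x; rw [gradLap, laplacian_eq_divg_gradient hV]
  rw [e]
  fun_prop

theorem exists_eq_sInf_closedBall {g : E d → ℝ} (hg : Continuous g) {R : ℝ} (hR : 0 ≤ R)
    (x : E d) : ∃ u, ‖u - x‖ ≤ R ∧ g u = sInf (g '' closedBall x R) := by
  obtain ⟨u, hu, h⟩ := (isCompact_closedBall x R).exists_sInf_image_eq
    (nonempty_closedBall.2 hR) hg.continuousOn
  exact ⟨u, by simpa [dist_eq_norm] using hu, h.symm⟩

/-- Translating to the origin moves the dependence on `x` from the compact set into the function. -/
theorem continuous_sInf_closedBall {g : E d → ℝ} (hg : Continuous g) (R : ℝ) :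
    Continuous fun x => sInf (g '' closedBall x R) := by
  have e : (fun x => sInf (g '' closedBall x R)) =
      fun x => sInf ((fun v => g (x + v)) '' closedBall 0 R) := by
    ext x
    congr 1
    ext y
    constructor
    · rintro ⟨u, hu, rfl⟩
      exact ⟨u - x, by simpa [dist_eq_norm] using hu, by simp⟩
    · rintro ⟨v, hv, rfl⟩
      exact ⟨x + v, by simpa using hv, rfl⟩
  rw [e]
  exact (isCompact_closedBall (0 : E d) R).continuous_sInf
    (f := fun x v => g (x + v)) (by simp only [Function.HasUncurry.uncurry, id]; fun_prop)

theorem norm_le_supportRadius {ν : Measure (E d)} (hν : IsCompact ν.support) {z : E d}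
    (hz : z ∈ ν.support) : ‖z‖ ≤ supportRadius ν :=
  le_csSup (hν.bddAbove_image continuous_norm.continuousOn) ⟨z, hz, rfl⟩

theorem supportRadius_nonneg (ν : Measure (E d)) : 0 ≤ supportRadius ν :=
  Real.sSup_nonneg (by rintro _ ⟨z, -, rfl⟩; exact norm_nonneg z)

/-! ### Reduction to a Riccati condition for the translates -/

/-- The weak Poincaré inequality for the convolution from Riccati conditions for all the
translates of the potential. -/
theorem weakPoincare_conv_of_riccati {V : E d → ℝ} (hV : ContDiff ℝ 1 V)
    [IsProbabilityMeasure (gibbs V)] (ν : Measure (E d)) [IsProbabilityMeasure ν]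
    (hν : IsCompact ν.support) {K κ : ℝ} (hK : 0 ≤ K) (hκ : 0 < κ) {φ : E d → ℝ}
    (hφ : Continuous φ) (hφ0 : ∀ x, 0 < φ x) (B : E d → E d → E d)
    (hB : ∀ z ∈ ν.support, ContDiffOn ℝ 1 (B z) {x | K < ‖x‖})
    (hR : ∀ z ∈ ν.support, ∀ x, K < ‖x‖ →
      divg (B z) x - inner ℝ (gradient V (x - z)) (B z x) + ‖B z x‖ ^ 2 ≤ -(κ * φ x)) :
    ∃ c : ℝ, 0 < c ∧ WeakPoincare (Measure.conv (gibbs V) ν)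
      fun r => c * genInv (beta (gibbs V) ν φ) r := by
  -- This ball contains `x - z` for all `|x| ≤ K + 2` and `z ∈ supp ν`, so a single `M`, hence a
  -- single `C`, serves every translate.
  obtain ⟨M, hM⟩ := (isCompact_closedBall (0 : E d) (K + 2 + supportRadius ν)).exists_bound_of_continuousOn
    hV.continuous.continuousOn
  obtain ⟨C, hC, h⟩ := exists_superlevel_poincare d (M := M) hK hκ
  refine weakPoincare_of_superlevel hφ hφ0 (gibbs V) ν (N := K + 2) hC (by linarith)
    fun f hf r hr => ?_
  refine conv_superlevel_le hV.continuous ν (measurableSet_le measurable_const hφ.measurable) hf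
    (by positivity) fun z hz => ?_
  refine h (fun x => V (x - z)) φ (B z) (hV.comp (contDiff_id.sub contDiff_const)) ?_ (fun x hx => ?_) hφ
    (fun x => (hφ0 x).le) (hB z hz) (fun x hx => ?_) f hf r hr
  · exact ⟨by rw [gibbs_translate_univ hV.continuous]; exact measure_lt_top _ _⟩
  · refine hM (x - z) ?_
    have h1 : ‖x‖ ≤ K + 2 := by simpa using hx
    have h2 := norm_le_supportRadius hν hz
    simpa using (norm_sub_le x z).trans (add_le_add h1 h2)
  · rw [gradient_comp_sub]
    exact hR z hz x hx

/-! ### Part (b) -/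

theorem divg_smul_translate_gradient {V : E d → ℝ} (hV : ContDiff ℝ 2 V) (a : ℝ) (z x : E d) :
    divg (fun y => a • gradient V (y - z)) x = a * Laplacian.laplacian V (x - z) := by
  have h1 := (contDiff_gradient hV).differentiable one_ne_zero
  have h2 : DifferentiableAt ℝ (fun y => gradient V (y - z)) x := by
    exact DifferentiableAt.comp (g := gradient V) (f := fun y => y - z) x (h1 (x - z))
      (by fun_prop)
  rw [laplacian_eq_divg_gradient hV, divg, divg, Finset.mul_sum]
  refine Finset.sum_congr rfl fun i _ => ?_
  rw [fderiv_fun_const_smul h2, fderiv_comp_sub]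
  simp

/-- The Lyapunov function is `exp((1 - δ) V(x - z))`. For its logarithmic gradient the Riccati
expression equals `-(1 - δ) (δ|∇V|² - ΔV)(x - z)`, and `x - z` lies in the ball over which `φ(x)` is
the infimum. -/
theorem weakPoincare_conv_of_gradLap {V : E d → ℝ} (hV : ContDiff ℝ 2 V)
    [IsProbabilityMeasure (gibbs V)] (ν : Measure (E d)) [IsProbabilityMeasure ν]
    (hν : IsCompact ν.support) {δ R₀ : ℝ} (hδ : δ < 1) (hR₀ : supportRadius ν < R₀)
    (hpos : ∀ x, R₀ ≤ ‖x‖ → 0 < gradLap V δ x) :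
    ∃ φ : E d → ℝ, Continuous φ ∧ (∀ x, 0 < φ x) ∧
      (∀ x, supportRadius ν + R₀ ≤ ‖x‖ →
        φ x = sInf (gradLap V δ '' closedBall x (supportRadius ν))) ∧
      BetaIsTail (gibbs V) ν φ (supportRadius ν + R₀) ∧
      ∃ c : ℝ, 0 < c ∧ WeakPoincare (Measure.conv (gibbs V) ν)
        fun r => c * genInv (beta (gibbs V) ν φ) r := by
  have hR := supportRadius_nonneg ν
  have hz0 (z : E d) (hz : z ∈ ν.support) := norm_le_supportRadius hν hz
  set R := supportRadius ν
  have hcont := continuous_gradLap hV δ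
  set Φ : E d → ℝ := fun x => sInf (gradLap V δ '' closedBall x R)
  have hΦ : Continuous Φ := continuous_sInf_closedBall hcont R
  have hΦpos (x : E d) (hx : R + R₀ ≤ ‖x‖) : 0 < Φ x := by
    obtain ⟨u, hu, he⟩ := exists_eq_sInf_closedBall hcont hR x
    refine (hpos u ?_).trans_eq he
    have := norm_sub_norm_le x u
    rw [norm_sub_rev] at this
    linarith
  -- `Φ` may fail to be positive inside the ball; the second entry is positive there and nonpositive
  -- outside.
  have heq (x : E d) (hx : R + R₀ ≤ ‖x‖) : max (Φ x) (R + R₀ - ‖x‖) = Φ x :=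
    max_eq_left (by linarith [hΦpos x hx])
  have hφ : Continuous fun x => max (Φ x) (R + R₀ - ‖x‖) := by fun_prop
  have hφ0 (x : E d) : 0 < max (Φ x) (R + R₀ - ‖x‖) := by
    rcases le_or_gt (R + R₀) ‖x‖ with hx | hx
    · rw [heq x hx]; exact hΦpos x hx
    · exact lt_max_of_lt_right (by linarith)
  refine ⟨_, hφ, hφ0, heq, ?_, ?_⟩
  · refine betaIsTail_of_ae_norm_le hφ hφ0 _ _ (by linarith) (show R < R + R₀ by linarith) ?_
    filter_upwards [Measure.support_mem_ae (μ := ν)] with z hz using hz0 z hz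
  · refine weakPoincare_conv_of_riccati (hV.of_le (by norm_num)) ν hν (K := R + R₀) (by linarith)
      (sub_pos.2 hδ) hφ hφ0 (fun z x => (1 - δ) • gradient V (x - z)) (fun z _ => ?_)
      fun z hz x hx => ?_
    · exact (((contDiff_gradient hV).comp (contDiff_id.sub contDiff_const)).const_smul _).contDiffOn
    · rw [heq x hx.le, divg_smul_translate_gradient hV, inner_smul_right,
        real_inner_self_eq_norm_sq, norm_smul, mul_pow, Real.norm_eq_abs, sq_abs]
      have h1 : Φ x ≤ gradLap V δ (x - z) :=
        csInf_le ((isCompact_closedBall x R).bddBelow_image hcont.continuousOn)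
          ⟨x - z, by simpa [dist_eq_norm] using hz0 z hz, rfl⟩
      have h2 := mul_le_mul_of_nonneg_left h1 (sub_pos.2 hδ).le
      simp only [gradLap] at h2
      linarith

/-! ### Part (a): radial fields and the functions `p_σ`, `η`, `ψ` -/

theorem gradient_comp_norm {q : ℝ → ℝ} {q' : ℝ} {x : E d} (hx : x ≠ 0)
    (hq : HasDerivAt q q' ‖x‖) : gradient (fun y => q ‖y‖) x = (q' / ‖x‖) • x := by
  have h1 : HasFDerivAt (fun y : E d => ‖y‖) (‖x‖⁻¹ • innerSL ℝ x) x := by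
    have h2 := ((hasStrictFDerivAt_norm_sq x).hasFDerivAt.sqrt (by simpa using hx))
    have e : (fun y : E d => ‖y‖) = fun y => √(‖y‖ ^ 2) := by
      ext y; rw [Real.sqrt_sq (norm_nonneg y)]
    rw [e]
    refine h2.congr_fderiv ?_
    rw [Real.sqrt_sq (norm_nonneg x)]
    ext v
    simp
    field_simp
  have h3 := (hq.comp_hasFDerivAt x h1).fderiv
  ext i
  rw [gradient_apply_coord]
  change fderiv ℝ (q ∘ fun y : E d => ‖y‖) x _ = _
  rw [h3]
  simp [EuclideanSpace.inner_single_right]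
  ring

/-- The divergence of a radial vector field. -/
theorem divg_radial {q : ℝ → ℝ} {q' : ℝ} {x : E d} (hx : x ≠ 0) (hq : HasDerivAt q q' ‖x‖) :
    divg (fun y => q ‖y‖ • y) x = ‖x‖ * q' + d * q ‖x‖ := by
  have h1 : DifferentiableAt ℝ (fun y : E d => q ‖y‖) x :=
    hq.differentiableAt.comp x ((contDiffAt_norm ℝ hx (n := 1)).differentiableAt one_ne_zero)
  have h2 : divg (fun y : E d => y) x = d := by
    simp [divg]
  have hx' : ‖x‖ ≠ 0 := norm_ne_zero_iff.2 hx
  rw [divg_mul_field h1 differentiableAt_fun_id, h2, gradient_comp_norm hx hq,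
    real_inner_smul_left, real_inner_self_eq_norm_sq]
  field_simp

theorem contDiffOn_one_of_hasDerivAt {F f : ℝ → ℝ} {s : Set ℝ} (hs : IsOpen s)
    (h : ∀ x ∈ s, HasDerivAt F (f x) x) (hf : ContinuousOn f s) : ContDiffOn ℝ 1 F s := by
  have := (contDiffOn_succ_iff_deriv_of_isOpen (𝕜 := ℝ) (n := 0) (f := F) hs).2
    ⟨fun x hx => (h x hx).differentiableAt.differentiableWithinAt, by simp,
      contDiffOn_zero.2 (hf.congr fun x hx => (h x hx).deriv)⟩
  simpa using this

theorem hasDerivAt_integral_of_continuousOn_Ioi {f : ℝ → ℝ} {R R₀ r : ℝ}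
    (hf : ContinuousOn f (Ioi R)) (hR₀ : R < R₀) (hr : R < r) :
    HasDerivAt (fun u => ∫ x in R₀..u, f x) (f r) r := by
  refine intervalIntegral.integral_hasDerivAt_right
    (ContinuousOn.intervalIntegrable (hf.mono fun x hx => ?_))
    (hf.stronglyMeasurableAtFilter isOpen_Ioi r hr) (hf.continuousAt (Ioi_mem_nhds hr))
  exact (lt_min hR₀ hr).trans_le hx.1

section weight

variable {ψ : ℝ → ℝ} {σ R R₀ r : ℝ}

theorem weight_pos (d : ℕ) (ψ : ℝ → ℝ) (σ R₀ : ℝ) (hr : 0 < r) : 0 < weight d ψ σ R₀ r :=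
  mul_pos (zpow_pos hr _) (Real.exp_pos _)

theorem hasDerivAt_weight (d : ℕ) (σ : ℝ) (hψ : ContinuousOn ψ (Ioi R)) (hR : 0 ≤ R)
    (hR₀ : R < R₀) (hr : R < r) :
    HasDerivAt (weight d ψ σ R₀)
      (weight d ψ σ R₀ r * ((1 - d) / r + σ / (σ + 1) * ψ r)) r := by
  have hr0 : r ≠ 0 := (hR.trans_lt hr).ne'
  have h1 := hasDerivAt_zpow (1 - (d : ℤ)) r (Or.inl hr0)
  have h2 := ((hasDerivAt_integral_of_continuousOn_Ioi hψ hR₀ hr).const_mul (σ / (σ + 1))).exp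
  refine (h1.mul h2).congr_deriv ?_
  rw [weight, zpow_sub_one₀ hr0]
  push_cast
  field_simp

theorem continuousOn_weight (d : ℕ) (σ : ℝ) (hψ : ContinuousOn ψ (Ioi R)) (hR : 0 ≤ R)
    (hR₀ : R < R₀) : ContinuousOn (weight d ψ σ R₀) (Ioi R) :=
  fun _ hr => (hasDerivAt_weight d σ hψ hR hR₀ hr).continuousAt.continuousWithinAt

theorem integral_weight_add_one_pos (d : ℕ) (ψ : ℝ → ℝ) (σ : ℝ) (hR₀ : 0 < R₀) (hr : R₀ ≤ r) :
    0 < (∫ s in R₀..r, weight d ψ σ R₀ s) + 1 := by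
  have : 0 ≤ ∫ s in R₀..r, weight d ψ σ R₀ s :=
    intervalIntegral.integral_nonneg hr fun u hu => (weight_pos d ψ σ R₀ (hR₀.trans_le hu.1)).le
  linarith

theorem pSigma_pos (d : ℕ) (ψ : ℝ → ℝ) (σ : ℝ) (hR₀ : 0 < R₀) (hr : R₀ ≤ r) :
    0 < pSigma d ψ σ R₀ r :=
  div_pos (integral_weight_add_one_pos d ψ σ hR₀ hr) (weight_pos d ψ σ R₀ (hR₀.trans_le hr))

/-- With `w` the weight, `b = 1 / p_σ` is the logarithmic derivative of `∫ w + 1`, so it solves the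
Riccati equation `b' = b (w'/w - b)`. -/
theorem hasDerivAt_inv_pSigma (d : ℕ) (σ : ℝ) (hψ : ContinuousOn ψ (Ioi R)) (hR : 0 ≤ R)
    (hR₀ : R < R₀) (hr : R₀ ≤ r) :
    HasDerivAt (fun u => (pSigma d ψ σ R₀ u)⁻¹)
      ((pSigma d ψ σ R₀ r)⁻¹ *
        ((1 - d) / r + σ / (σ + 1) * ψ r - (pSigma d ψ σ R₀ r)⁻¹)) r := by
  have hr' := hR₀.trans_le hr
  have h1 := hasDerivAt_weight d σ hψ hR hR₀ hr'
  have h2 := (hasDerivAt_integral_of_continuousOn_Ioi (continuousOn_weight d σ hψ hR hR₀)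
    hR₀ hr').add_const 1
  have h3 := (integral_weight_add_one_pos d ψ σ (hR.trans_lt hR₀) hr).ne'
  have e : (fun u => (pSigma d ψ σ R₀ u)⁻¹) =
      fun u => weight d ψ σ R₀ u / ((∫ s in R₀..u, weight d ψ σ R₀ s) + 1) := by
    ext u; rw [pSigma, inv_div]
  rw [e]
  refine (h1.div h2 h3).congr_deriv ?_
  rw [pSigma, inv_div]
  field_simp

end weight

theorem continuousOn_eta {V : E d → ℝ} (hV : ContDiff ℝ 1 V) (R : ℝ) :
    ContinuousOn (eta V R) (Ioi 0) := by
  have hg := continuous_gradient hV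
  have h : Continuous fun s : ℝ => sInf ((fun x : E d =>
      inner ℝ (gradient V (s • x)) (s • x) - R * ‖gradient V (s • x)‖) '' sphere 0 1) :=
    (isCompact_sphere (0 : E d) 1).continuous_sInf
      (f := fun (s : ℝ) (x : E d) =>
        inner ℝ (gradient V (s • x)) (s • x) - R * ‖gradient V (s • x)‖)
      (by simp only [Function.HasUncurry.uncurry, id]; fun_prop)
  refine h.continuousOn.congr fun s hs => ?_
  have hs0 : (0 : ℝ) < s := hs
  rw [eta]
  congr 1
  ext y
  constructor
  · rintro ⟨x, hx, rfl⟩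
    have hx' : ‖x‖ = s := by simpa using hx
    refine ⟨s⁻¹ • x, by simp [norm_smul, hx', abs_of_pos hs0, hs0.ne'], ?_⟩
    simp only [smul_inv_smul₀ hs0.ne']
  · rintro ⟨x, hx, rfl⟩
    have hx' : ‖x‖ = 1 := by simpa using hx
    exact ⟨s • x, by simp [norm_smul, hx', abs_of_pos hs0], rfl⟩

theorem eta_le {V : E d → ℝ} (hV : ContDiff ℝ 1 V) (R : ℝ) (y : E d) :
    eta V R ‖y‖ ≤ inner ℝ (gradient V y) y - R * ‖gradient V y‖ := by
  have hg := continuous_gradient hV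
  exact csInf_le ((isCompact_sphere (0 : E d) ‖y‖).bddBelow_image
    (Continuous.continuousOn (by fun_prop))) ⟨y, by simp, rfl⟩

/-- The moving interval is shifted to `[-R, R]`. Truncating the argument of `η` at `a - R > 0` keeps
it where `η` is continuous and changes nothing for `r > a`. -/
theorem continuousOn_psi {V : E d → ℝ} (hV : ContDiff ℝ 1 V) {R : ℝ} (hR : 0 ≤ R) :
    ContinuousOn (psi V R) (Ioi R) := by
  intro r₀ hr₀
  have hr₀' : R < r₀ := hr₀
  obtain ⟨a, ha, har⟩ := exists_between hr₀'
  have haR : 0 < a - R := sub_pos.2 ha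
  have hc : Continuous fun s => eta V R (max s (a - R)) := by
    refine (continuousOn_eta hV R).comp_continuous (by fun_prop) fun s => ?_
    exact haR.trans_le (le_max_right _ _)
  have h : Continuous fun r : ℝ => sInf ((fun t => eta V R (max (r + t) (a - R))) '' Icc (-R) R) :=
    isCompact_Icc.continuous_sInf (f := fun r t : ℝ => eta V R (max (r + t) (a - R)))
      (by
        simp only [Function.HasUncurry.uncurry, id]
        exact hc.comp (continuous_fst.add continuous_snd))
  have h2 : ContinuousAt (fun r : ℝ => 1 / r *
      sInf ((fun t => eta V R (max (r + t) (a - R))) '' Icc (-R) R)) r₀ :=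
    (continuousAt_const.div continuousAt_id (hR.trans_lt hr₀').ne').mul h.continuousAt
  refine (h2.congr ?_).continuousWithinAt
  filter_upwards [Ioi_mem_nhds har] with r hr
  have hr' : a < r := hr
  rw [psi]
  congr 2
  ext y
  constructor
  · rintro ⟨t, ht, rfl⟩
    refine ⟨r + t, ⟨by linarith [ht.1], by linarith [ht.2]⟩, ?_⟩
    simp only
    rw [max_eq_left (by linarith [ht.1])]
  · rintro ⟨s, hs, rfl⟩
    refine ⟨s - r, ⟨by linarith [hs.1], by linarith [hs.2]⟩, ?_⟩
    simp only
    rw [max_eq_left (by linarith [hs.1]), add_sub_cancel]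

theorem psi_pos {V : E d → ℝ} (hV : ContDiff ℝ 1 V) {R R₀ r : ℝ} (hR : 0 ≤ R) (hR₀ : R < R₀)
    (hη : ∀ s, R₀ ≤ s → 0 < eta V R s) (hr : R + R₀ ≤ r) : 0 < psi V R r := by
  obtain ⟨s, hs, h⟩ := isCompact_Icc.exists_sInf_image_eq
    (nonempty_Icc.2 (show r - R ≤ r + R by linarith))
    ((continuousOn_eta hV R).mono fun s hs => show 0 < s by linarith [hs.1])
  rw [psi, h]
  exact mul_pos (one_div_pos.2 (by linarith)) (hη s (by linarith [hs.1]))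

/-- Write `x = (x - z) + z`: the loss `⟨∇V(x - z), z⟩ ≥ -R |∇V(x - z)|` is exactly the term
subtracted in `η`, and `|x - z|` is within `R` of `|x|`. -/
theorem psi_mul_le_inner {V : E d → ℝ} (hV : ContDiff ℝ 1 V) {R : ℝ} {x z : E d}
    (hz : ‖z‖ ≤ R) (hx : R < ‖x‖) : psi V R ‖x‖ * ‖x‖ ≤ inner ℝ (gradient V (x - z)) x := by
  have hx0 : 0 < ‖x‖ := (norm_nonneg z).trans_lt (hz.trans_lt hx)
  have h1 := eta_le hV R (x - z)
  have h2 : sInf (eta V R '' Icc (‖x‖ - R) (‖x‖ + R)) ≤ eta V R ‖x - z‖ := by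
    refine csInf_le (isCompact_Icc.bddBelow_image
      ((continuousOn_eta hV R).mono fun s hs => show 0 < s by linarith [hs.1])) ⟨‖x - z‖, ⟨?_, ?_⟩, rfl⟩
    · linarith [norm_sub_norm_le x z]
    · linarith [norm_sub_le x z]
  have h3 : psi V R ‖x‖ * ‖x‖ = sInf (eta V R '' Icc (‖x‖ - R) (‖x‖ + R)) := by
    rw [psi]; field_simp
  have h4 := abs_real_inner_le_norm (gradient V (x - z)) z
  have h5 := mul_le_mul_of_nonneg_left hz (norm_nonneg (gradient V (x - z)))
  rw [inner_sub_right] at h1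
  have h6 := neg_abs_le (inner ℝ (gradient V (x - z)) z)
  linarith

/-- With `b = 1 / p_σ` and `B = b(|x|) x / |x|`, the Riccati equation gives `div B + |B|² = σ/(σ+1)
bψ`, while the drift contributes at most `-bψ` for every `z`. The remainder `-bψ/(σ+1)` is `-φ`. -/
theorem weakPoincare_conv_of_eta {V : E d → ℝ} (hV : ContDiff ℝ 1 V)
    [IsProbabilityMeasure (gibbs V)] (ν : Measure (E d)) [IsProbabilityMeasure ν]
    (hν : IsCompact ν.support) {R R₀ σ : ℝ} (hR' : R = supportRadius ν) (hR₀ : R < R₀)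
    (hη : ∀ s, R₀ ≤ s → 0 < eta V R s) (hσ : 0 < σ) :
    ∃ φ : E d → ℝ, Continuous φ ∧ (∀ x, 0 < φ x) ∧
      (∀ x, R + R₀ ≤ ‖x‖ →
        φ x = psi V R ‖x‖ / ((σ + 1) * pSigma d (psi V R) σ R₀ ‖x‖)) ∧
      BetaIsTail (gibbs V) ν φ (R + R₀) ∧
      ∃ c : ℝ, 0 < c ∧ WeakPoincare (Measure.conv (gibbs V) ν)
        fun r => c * genInv (beta (gibbs V) ν φ) r := by
  have hR : 0 ≤ R := hR' ▸ supportRadius_nonneg ν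
  have hz0 (z : E d) (hz : z ∈ ν.support) : ‖z‖ ≤ R := hR' ▸ norm_le_supportRadius hν hz
  have hR₀0 : 0 < R₀ := hR.trans_lt hR₀
  have hψ := continuousOn_psi hV hR
  set ψ := psi V R
  set b : ℝ → ℝ := fun r => (pSigma d ψ σ R₀ r)⁻¹
  have hb' {r : ℝ} (hr : R₀ ≤ r) := hasDerivAt_inv_pSigma d σ hψ hR hR₀ hr
  have hbpos {r : ℝ} (hr : R₀ ≤ r) : 0 < b r := inv_pos.2 (pSigma_pos d ψ σ hR₀0 hr)
  have hbc : ContinuousOn b (Ici R₀) := fun r hr => (hb' hr).continuousAt.continuousWithinAt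
  have hψc : ContinuousOn ψ (Ici R₀) := hψ.mono fun r hr => hR₀.trans_le hr
  set K := R + R₀
  have hKR₀ : R₀ ≤ K := le_add_of_nonneg_left hR
  set Φ : ℝ → ℝ := fun r => ψ r / ((σ + 1) * pSigma d ψ σ R₀ r)
  have hΦe (r : ℝ) : Φ r = ψ r * b r / (σ + 1) := by
    simp only [Φ, b]; rw [div_mul_eq_div_div_swap, div_eq_mul_inv (ψ r)]
  have hΦc : ContinuousOn Φ (Ici R₀) := by
    rw [show Φ = fun r => ψ r * b r / (σ + 1) from funext hΦe]
    exact (hψc.mul hbc).div_const _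
  -- Inside the ball `φ` is frozen at its boundary value, since `ψ` is known to be positive only
  -- from `K` on.
  have hφ : Continuous fun x : E d => Φ (max ‖x‖ K) :=
    hΦc.comp_continuous (by fun_prop) fun x => hKR₀.trans (le_max_right _ _)
  have hφ0 (x : E d) : 0 < Φ (max ‖x‖ K) := by
    have hle : K ≤ max ‖x‖ K := le_max_right _ _
    rw [hΦe]
    exact div_pos (mul_pos (psi_pos hV hR hR₀ hη hle) (hbpos (hKR₀.trans hle))) (by linarith)
  have heq (x : E d) (hx : K ≤ ‖x‖) : Φ (max ‖x‖ K) = Φ ‖x‖ := by rw [max_eq_left hx]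
  refine ⟨_, hφ, hφ0, heq, ?_, ?_⟩
  · refine betaIsTail_of_ae_norm_le hφ hφ0 _ _ (by linarith) (show R < K by simp only [K]; linarith) ?_
    filter_upwards [Measure.support_mem_ae (μ := ν)] with z hz using hz0 z hz
  set q : ℝ → ℝ := fun r => b r / r
  have hq {r : ℝ} (hr : R₀ ≤ r) : HasDerivAt q
      (q r * ((1 - d) / r + σ / (σ + 1) * ψ r - b r - 1 / r)) r := by
    have hr0 : r ≠ 0 := (hR₀0.trans_le hr).ne'
    refine ((hb' hr).div (hasDerivAt_id r) hr0).congr_deriv ?_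
    simp only [q, b, id]
    field_simp
  have hqc : ContDiffOn ℝ 1 q (Ioi K) := by
    have hid : ContinuousOn (fun r : ℝ => r) (Ioi K) := continuousOn_id
    have hne : ∀ r ∈ Ioi K, r ≠ 0 := fun r hr => (hR₀0.trans_le (hKR₀.trans (le_of_lt hr))).ne'
    have hsub : Ioi K ⊆ Ici R₀ := fun r hr => hKR₀.trans (le_of_lt hr)
    refine contDiffOn_one_of_hasDerivAt isOpen_Ioi (fun r hr => hq (hsub hr)) ?_
    have h1 := hbc.mono hsub
    have h2 := hψc.mono hsub
    exact (h1.div hid hne).mul ((((continuousOn_const.div hid hne).add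
      (continuousOn_const.mul h2)).sub h1).sub (continuousOn_const.div hid hne))
  refine weakPoincare_conv_of_riccati hV ν hν (K := K) (κ := 1) (by linarith) one_pos hφ hφ0
    (fun _ x => q ‖x‖ • x) (fun z _ => ?_) fun z hz x hx => ?_
  · have hn : ContDiffOn ℝ 1 (fun x : E d => ‖x‖) {x | K < ‖x‖} := fun x hx =>
      (contDiffAt_norm ℝ (norm_pos_iff.1
        ((hR₀0.trans_le hKR₀).trans (show K < ‖x‖ from hx)))).contDiffWithinAt
    exact (hqc.comp hn fun x hx => hx).smul contDiffOn_id
  · have hx0 : 0 < ‖x‖ := (hR₀0.trans_le hKR₀).trans hx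
    have hxR₀ : R₀ ≤ ‖x‖ := hKR₀.trans hx.le
    have hbx := hbpos hxR₀
    rw [heq x hx.le, divg_radial (norm_pos_iff.1 hx0) (hq hxR₀), inner_smul_right, norm_smul,
      Real.norm_eq_abs, abs_of_pos (div_pos hbx hx0), hΦe]
    have h1 := psi_mul_le_inner hV (hz0 z hz) (hR₀.trans_le hxR₀)
    have h2 := mul_le_mul_of_nonneg_left h1 (div_pos hbx hx0).le
    have e1 : b ‖x‖ / ‖x‖ * (ψ ‖x‖ * ‖x‖) = b ‖x‖ * ψ ‖x‖ := by field_simp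
    change b ‖x‖ / ‖x‖ * (ψ ‖x‖ * ‖x‖) ≤ _ at h2
    rw [e1] at h2
    -- The dimension terms cancel through the factor `r^{1-d}` of the weight, and `|B|² = b²`
    -- cancels the quadratic Riccati term.
    have e2 : ‖x‖ * (q ‖x‖ * ((1 - d) / ‖x‖ + σ / (σ + 1) * ψ ‖x‖ - b ‖x‖ - 1 / ‖x‖)) +
        d * q ‖x‖ + (b ‖x‖ / ‖x‖ * ‖x‖) ^ 2 = σ / (σ + 1) * (b ‖x‖ * ψ ‖x‖) := by
      simp only [q]
      field_simp
      ring
    have e3 : b ‖x‖ * ψ ‖x‖ - σ / (σ + 1) * (b ‖x‖ * ψ ‖x‖) = 1 * (ψ ‖x‖ * b ‖x‖ / (σ + 1)) := by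
      field_simp
      ring
    linarith

end WeakPoincareConv

open WeakPoincareConv in
theorem corollary1p3 {d : ℕ} (hd : 1 ≤ d) (V : E d → ℝ) (hV : ContDiff ℝ 1 V)
    (hμ : IsProbabilityMeasure (gibbs V))
    (ν : Measure (E d)) [IsProbabilityMeasure ν] (hν : IsCompact ν.support)
    (R : ℝ) (hR : R = supportRadius ν) :
    -- Part (a)
    (∀ R₀ : ℝ, R < R₀ → (∀ s : ℝ, R₀ ≤ s → 0 < eta V R s) →
      ∀ σ : ℝ, 0 < σ →
      ∃ ϕ : E d → ℝ, Continuous ϕ ∧ (∀ x, 0 < ϕ x) ∧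
        (∀ x, R + R₀ ≤ ‖x‖ →
          ϕ x = psi V R ‖x‖ / ((σ + 1) * pSigma d (psi V R) σ R₀ ‖x‖)) ∧
        BetaIsTail (gibbs V) ν ϕ (R + R₀) ∧
        ∃ c : ℝ, 0 < c ∧
          WeakPoincare (Measure.conv (gibbs V) ν)
            (fun r => c * genInv (beta (gibbs V) ν ϕ) r)) ∧
    -- Part (b)
    (ContDiff ℝ 2 V → ∀ δ : ℝ, 0 < δ → δ < 1 → ∀ R₀ : ℝ, R < R₀ →
      (∀ x, R₀ ≤ ‖x‖ → 0 < gradLap V δ x) →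
      ∃ ϕ : E d → ℝ, Continuous ϕ ∧ (∀ x, 0 < ϕ x) ∧
        (∀ x, R + R₀ ≤ ‖x‖ → ϕ x = sInf (gradLap V δ '' closedBall x R)) ∧
        BetaIsTail (gibbs V) ν ϕ (R + R₀) ∧
        ∃ c : ℝ, 0 < c ∧
          WeakPoincare (Measure.conv (gibbs V) ν)
            (fun r => c * genInv (beta (gibbs V) ν ϕ) r)) := by
  refine ⟨fun R₀ hR₀ hη σ hσ => weakPoincare_conv_of_eta hV ν hν hR hR₀ hη hσ,
    fun hV2 δ _ hδ R₀ hR₀ hpos => ?_⟩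
  subst hR
  exact weakPoincare_conv_of_gradLap hV2 ν hν hδ hR₀ hpos
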